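/- Call a set $S\subseteq\mathbb{Z}^2$ sum-free if there are no (not necessarily distinct) $a,b,c\in S$ with $a+b=c$, addition being coordinatewise. For a positive integer $n$, let $R_0=R_0(n)$ be the set of lattice points $(x,y)\in\mathbb{Z}^2\cap[0,n]^2$ with $0.7n\le x+y\le 1.7n$. Then the number of sum-free subsets of $R_0(n)$ is at most $2^{0.6n^2+O(n)}$; that is, there is an absolute constant $C$ such that for every $n\ge 1$ the number of sum-free subsets of $R_0(n)$ is at most $2^{0.6n^2+Cn}$. -/

import Mathlib

/-- A set `S` is sum-free if there are no (not necessarily distinct) `a, b, c ∈ S`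
with `a + b = c`. -/
def IsSumFreeSet {G : Type*} [AddCommGroup G] (S : Set G) : Prop :=
  ∀ a ∈ S, ∀ b ∈ S, ∀ c ∈ S, a + b ≠ c

/-- The set `Λ(R)` of lattice points (points of `ℤ²`) of a planar region `R`. -/
def latticePoints (R : Set (ℝ × ℝ)) : Set (ℤ × ℤ) :=
  {p | ((p.1 : ℝ), (p.2 : ℝ)) ∈ R}

/-- The number of sum-free subsets of a finite set `R`. -/
noncomputable def sumFreeCount {G : Type*} [AddCommGroup G] (R : Set G) : ℕ :=
  {S : Set G | S ⊆ R ∧ IsSumFreeSet S}.ncard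

/-- The region `{(x, y) ∈ [0, n]² : 0.7 n ≤ x + y ≤ 1.7 n}`. -/
def regionR0 (n : ℕ) : Set (ℝ × ℝ) :=
  {p | p.1 ∈ Set.Icc (0 : ℝ) n ∧ p.2 ∈ Set.Icc (0 : ℝ) n ∧
    0.7 * (n : ℝ) ≤ p.1 + p.2 ∧ p.1 + p.2 ≤ 1.7 * (n : ℝ)}

/-- The set of lattice points of `regionR0 n` is finite. -/
theorem latticePoints_regionR0_finite (n : ℕ) : (latticePoints (regionR0 n)).Finite := by
  refine (Set.finite_Icc ((0 : ℤ), (0 : ℤ)) ((n : ℤ), (n : ℤ))).subset ?_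
  rintro ⟨x, y⟩ ⟨⟨hx0, hx1⟩, ⟨hy0, hy1⟩, -⟩
  simp only at hx0 hx1 hy0 hy1
  have h1 : 0 ≤ x := by exact_mod_cast hx0
  have h2 : 0 ≤ y := by exact_mod_cast hy0
  have h3 : x ≤ n := by exact_mod_cast hx1
  have h4 : y ≤ n := by exact_mod_cast hy1
  exact ⟨⟨h1, h2⟩, ⟨h3, h4⟩⟩

/-- For finite `R` the family counted by `sumFreeCount` is finite, so that `sumFreeCount R`
is its actual cardinality. -/
theorem sumFreeSubsets_finite {G : Type*} [AddCommGroup G] {R : Set G} (hR : R.Finite) :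
    {S : Set G | S ⊆ R ∧ IsSumFreeSet S}.Finite :=
  hR.finite_subsets.subset fun _ hS => hS.1

/-! Put `q = n / 10` and work modulo `O(n)` in the exponent. Cut the region along lines of constant
`x + y` and along columns. The columns `x ∈ [0, 8q]` except `x = 6q`, restricted to `7q ≤ x + y <
10q + 17`, form the low strip; the columns `x ∈ [6q + 2, 10q - 3]`, restricted to `14q ≤ x + y < 17q
+ 17`, form the high strip. Points outside both are counted trivially and contribute `36q²`. The low
strip contributes `24q²`, and the high strip must cost only `O(q)` more, for a total of `60q² ≤
0.6n²`.

The low columns split into two chains of pairs `(Xⱼ, Yⱼ)`, at columns `x₀ + j` and `y₀ + j`. The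
high column `x₀ + y₀ + 2j` has trace `Cⱼ`, and sum-freeness makes `Cⱼ` avoid `Xⱼ + Yⱼ`, `Xⱼ₊₁ +
Yⱼ₋₁` and `Xⱼ₋₁ + Yⱼ₊₁`. One chain has at most `2 ^ (2kL + O(k + L))` configurations
(`card_chainConfigs_le`), so each `Cⱼ` costs a bounded factor.

Each pair enters at most three consecutive constraints, so Hölder with exponent 3
(`sum_chainProd_le`) reduces the count to cubes `(2 ^ #free)³ = 8 ^ #free` for six independent sets,
regrouped into three pairs. Fix the least elements `α`, `β` of each pair and set `τ = α + β`.
Positions up to `τ` may be free, but prescribing `α` and `β` loses the factor `2 ^ τ` that pays for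
them. Beyond `τ`, `α + Y` and `X + β` leave a position free with probability `1/4`, while the last
free position `T` is avoided by the whole sumset with probability exponentially small in `T - τ`.
Together these give a bound decaying in `|T - τᵢ|` for each pair, hence in the differences of the
`τᵢ` (`sum_pairs_pow_card_unblocked_le_gap`). That decay makes the sum over all sequences of least
elements cost only a constant per step (`sum_pow_deviation_le`). -/

section

open Finset

/-! ### Random sets with prescribed least element. -/

/-- The least element of `X`, or `L` if `X` has no element below `L`. -/
def lowest (L : ℕ) (X : Finset ℕ) : ℕ := (insert L X).min' (insert_nonempty L X)

lemma lowest_le (L : ℕ) (X : Finset ℕ) : lowest L X ≤ L :=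
  min'_le _ _ (mem_insert_self L X)

lemma lowest_le_of_mem {L : ℕ} {X : Finset ℕ} {a : ℕ} (ha : a ∈ X) : lowest L X ≤ a :=
  min'_le _ _ (mem_insert_of_mem ha)

lemma lowest_mem {L : ℕ} {X : Finset ℕ} (h : lowest L X < L) : lowest L X ∈ X := by
  rcases mem_insert.1 (min'_mem (insert L X) (insert_nonempty L X)) with h' | h'
  · exact absurd h' h.ne
  · exact h'

/-- The subsets of `{0, …, L - 1}` with least element `α` (the empty set if `α = L`). -/
def envelope (L α : ℕ) : Finset (Finset ℕ) :=
  (range L).powerset.filter fun X => lowest L X = α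

lemma mem_envelope {L α : ℕ} {X : Finset ℕ} :
    X ∈ envelope L α ↔ X ⊆ range L ∧ lowest L X = α := by
  simp [envelope]

/-- A set with least element `α` is determined by its part above `α`, which is an arbitrary subset
of `Ioo α L`. -/
lemma sum_envelope_le_sum_powerset (L α : ℕ) (φ : Finset ℕ → ℝ) (hφ : ∀ X, 0 ≤ φ X)
    (hloc : ∀ X, φ (X ∩ Ioo α L) = φ X) :
    ∑ X ∈ envelope L α, φ X ≤ ∑ V ∈ (Ioo α L).powerset, φ V := by
  calc ∑ X ∈ envelope L α, φ X
      = ∑ X ∈ envelope L α, φ (X ∩ Ioo α L) := by simp_rw [hloc]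
    _ = ∑ V ∈ (envelope L α).image (fun X => X ∩ Ioo α L), φ V := by
        rw [sum_image]
        intro X hX Y hY hXY
        rw [mem_coe, mem_envelope] at hX hY
        have key : ∀ X Y : Finset ℕ, X ⊆ range L → lowest L X = α → Y ⊆ range L →
            lowest L Y = α → X ∩ Ioo α L = Y ∩ Ioo α L → X ⊆ Y := by
          intro X Y hX hXα hY hYα h a ha
          have haL : a < L := mem_range.1 (hX ha)
          have hαa : α ≤ a := hXα ▸ lowest_le_of_mem ha
          rcases hαa.eq_or_lt with rfl | hlt
          · have := lowest_mem (L := L) (X := Y) (by omega)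
            rwa [hYα] at this
          · have : a ∈ Y ∩ Ioo α L := h ▸ mem_inter.2 ⟨ha, mem_Ioo.2 ⟨hlt, haL⟩⟩
            exact (mem_inter.1 this).1
        exact Subset.antisymm (key X Y hX.1 hX.2 hY.1 hY.2 hXY)
          (key Y X hY.1 hY.2 hX.1 hX.2 hXY.symm)
    _ ≤ _ := by
        apply sum_le_sum_of_subset_of_nonneg
        · intro V hV
          obtain ⟨X, -, rfl⟩ := mem_image.1 hV
          exact mem_powerset.2 inter_subset_right
        · intros; exact hφ _

/-- Independence: for injective `σ` the events `σ c ∈ V` are independent fair coins, so the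
expectation of the product factorises. -/
lemma sum_powerset_prod_image (s I : Finset ℕ) (σ : ℕ → ℕ) (hσ : Set.InjOn σ I)
    (hs : ∀ c ∈ I, σ c ∈ s) (p κ : ℕ → ℝ) :
    ∑ V ∈ s.powerset, ∏ c ∈ I, (p c + κ c * if σ c ∈ V then 0 else 1) =
      2 ^ #s * ∏ c ∈ I, (p c + κ c / 2) := by
  induction I using Finset.induction_on generalizing s with
  | empty => simp
  | insert c I hc ih =>
    have hcs : σ c ∈ s := hs c (mem_insert_self _ _)
    have hI : ∀ d ∈ I, σ d ∈ s.erase (σ c) := by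
      intro d hd
      refine mem_erase.2 ⟨fun h => hc ?_, hs d (mem_insert_of_mem hd)⟩
      have := hσ (by simp [hd]) (by simp) h
      exact this ▸ hd
    have hih := ih (s.erase (σ c)) (hσ.mono (by simp)) hI
    have hcard : #s = #(s.erase (σ c)) + 1 := (card_erase_add_one hcs).symm
    rw [← insert_erase hcs, sum_powerset_insert (notMem_erase _ _), insert_erase hcs, hcard]
    have h1 : ∀ V ∈ (s.erase (σ c)).powerset,
        ∏ d ∈ insert c I, (p d + κ d * if σ d ∈ V then 0 else 1) =
        (p c + κ c) * ∏ d ∈ I, (p d + κ d * if σ d ∈ V then 0 else 1) := by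
      intro V hV
      have : σ c ∉ V := fun h => notMem_erase _ _ (mem_powerset.1 hV h)
      rw [prod_insert hc, if_neg this, mul_one]
    have h2 : ∀ V ∈ (s.erase (σ c)).powerset,
        ∏ d ∈ insert c I, (p d + κ d * if σ d ∈ insert (σ c) V then 0 else 1) =
        p c * ∏ d ∈ I, (p d + κ d * if σ d ∈ V then 0 else 1) := by
      intro V hV
      rw [prod_insert hc, if_pos (mem_insert_self _ _), mul_zero, add_zero]
      congr 1
      refine prod_congr rfl fun d hd => ?_
      have : σ d ≠ σ c := (mem_erase.1 (hI d hd)).1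
      simp [mem_insert, this]
    rw [sum_congr rfl h1, sum_congr rfl h2, ← mul_sum, ← mul_sum, hih, prod_insert hc]
    ring

lemma sum_envelope_prod_le (L α : ℕ) (I : Finset ℕ) (J : ℕ → Prop) [DecidablePred J]
    (σ : ℕ → ℕ) (hσ : Set.InjOn σ {c | c ∈ I ∧ J c})
    (hs : ∀ c ∈ I, J c → α < σ c ∧ σ c < L) (p κ : ℕ → ℝ) (hp : ∀ c, 0 ≤ p c)
    (hκ : ∀ c, 0 ≤ κ c) :
    ∑ X ∈ envelope L α, ∏ c ∈ I, (p c + κ c * if J c ∧ σ c ∈ X then 0 else 1) ≤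
      2 ^ (L - α) * ∏ c ∈ I, (p c + κ c * if J c then 1 / 2 else 1) := by
  have hsplit : ∀ X : Finset ℕ, ∏ c ∈ I, (p c + κ c * if J c ∧ σ c ∈ X then 0 else 1) =
      (∏ c ∈ I with J c, (p c + κ c * if σ c ∈ X then 0 else 1)) *
        ∏ c ∈ I with ¬ J c, (p c + κ c) := by
    intro X
    rw [← prod_filter_mul_prod_filter_not I J]
    congr 1
    · refine prod_congr rfl fun c hc => ?_
      simp [(mem_filter.1 hc).2]
    · refine prod_congr rfl fun c hc => ?_
      simp [(mem_filter.1 hc).2]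
  have hq : 0 ≤ ∏ c ∈ I with ¬ J c, (p c + κ c) :=
    prod_nonneg fun c _ => add_nonneg (hp c) (hκ c)
  simp_rw [hsplit]
  rw [← sum_mul, ← prod_filter_mul_prod_filter_not I J
    (fun c => p c + κ c * if J c then (1 / 2 : ℝ) else 1), ← mul_assoc]
  have e1 : ∏ c ∈ I with ¬ J c, (p c + κ c * if J c then (1 / 2 : ℝ) else 1) =
      ∏ c ∈ I with ¬ J c, (p c + κ c) :=
    prod_congr rfl fun c hc => by simp [(mem_filter.1 hc).2]
  have e2 : ∏ c ∈ I with J c, (p c + κ c * if J c then (1 / 2 : ℝ) else 1) =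
      ∏ c ∈ I with J c, (p c + κ c / 2) :=
    prod_congr rfl fun c hc => by simp [(mem_filter.1 hc).2]; ring
  rw [e1, e2]
  refine mul_le_mul_of_nonneg_right ?_ hq
  have hmem : ∀ c ∈ I.filter J, σ c ∈ Ioo α L := fun c hc =>
    mem_Ioo.2 (hs c (mem_filter.1 hc).1 (mem_filter.1 hc).2)
  refine (sum_envelope_le_sum_powerset L α _ ?_ ?_).trans ?_
  · intro X
    refine prod_nonneg fun c _ => add_nonneg (hp c) (mul_nonneg (hκ c) ?_)
    split_ifs <;> norm_num
  · intro X
    refine prod_congr rfl fun c hc => ?_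
    simp [mem_inter, hmem c hc, -mem_Ioo]
  · rw [sum_powerset_prod_image _ _ σ ?_ hmem]
    · refine mul_le_mul_of_nonneg_right ?_
        (prod_nonneg fun c _ => add_nonneg (hp c) (by have := hκ c; positivity))
      refine pow_le_pow_right₀ (by norm_num) ?_
      rw [Nat.card_Ioo]; omega
    · intro a ha b hb h
      simp only [coe_filter, Set.mem_ofPred_eq] at ha hb
      exact hσ ha hb h

lemma card_envelope_le (L α : ℕ) : (#(envelope L α) : ℝ) ≤ 2 ^ (L - α) := by
  have := sum_envelope_prod_le L α ∅ (fun _ => False) id (by simp) (by simp) 0 0 (by simp) (by simp)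
  simpa using this

/-- The pairs of subsets of `{0, …, L - 1}` with prescribed least elements. -/
def pairEnvelope (L α β : ℕ) : Finset (Finset ℕ × Finset ℕ) := envelope L α ×ˢ envelope L β

/-- `freeAt α β Z c` is `1` if `c` is neither of the form `α + y` with `y ∈ Z.2`, nor `x + β` with
`x ∈ Z.1`, or if `c ≤ α + β`; otherwise it is `0`. -/
def freeAt (α β : ℕ) (Z : Finset ℕ × Finset ℕ) (c : ℕ) : ℝ :=
  (if α + β < c ∧ c - β ∈ Z.1 then 0 else 1) * if α + β < c ∧ c - α ∈ Z.2 then 0 else 1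

lemma freeAt_nonneg (α β : ℕ) (Z : Finset ℕ × Finset ℕ) (c : ℕ) : 0 ≤ freeAt α β Z c := by
  unfold freeAt; split_ifs <;> norm_num

/-- Beyond `α + β`, each `c` is tested by one coin of `X` and one of `Y`, and distinct `c` use
distinct coins; averaging over `Y` and then over `X` gives `1/2 * 1/2`. -/
lemma sum_pairEnvelope_prod_le (L α β T : ℕ) (hT : T ≤ L) (p κ : ℕ → ℝ) (hp : ∀ c, 0 ≤ p c)
    (hκ : ∀ c, 0 ≤ κ c) :
    ∑ Z ∈ pairEnvelope L α β, ∏ c ∈ range T, (p c + κ c * freeAt α β Z c) ≤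
      2 ^ (L - α) * 2 ^ (L - β) *
        ∏ c ∈ range T, (p c + κ c * if α + β < c then 1 / 4 else 1) := by
  rw [pairEnvelope, sum_product]
  have h1 : ∀ X ∈ envelope L α, ∑ Y ∈ envelope L β,
      ∏ c ∈ range T, (p c + κ c * freeAt α β (X, Y) c) ≤
      2 ^ (L - β) * ∏ c ∈ range T, (p c + (κ c * if α + β < c then 1 / 2 else 1) *
        if α + β < c ∧ c - β ∈ X then 0 else 1) := by
    intro X _
    have := sum_envelope_prod_le L β (range T) (fun c => α + β < c) (fun c => c - α) ?_ ?_ p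
      (fun c => κ c * if α + β < c ∧ c - β ∈ X then 0 else 1) hp ?_
    · refine le_trans (le_of_eq ?_) (this.trans (le_of_eq ?_))
      · refine sum_congr rfl fun Y _ => prod_congr rfl fun c _ => ?_
        simp only [freeAt]; ring
      · congr 1
        refine prod_congr rfl fun c _ => ?_
        ring
    · intro a ha b hb h
      simp only [Set.mem_ofPred_eq] at ha hb h
      omega
    · intro c hc h
      have := mem_range.1 hc
      omega
    · intro c
      refine mul_nonneg (hκ c) ?_
      split_ifs <;> norm_num
  refine (sum_le_sum h1).trans ?_
  rw [← mul_sum]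
  have h2 := sum_envelope_prod_le L α (range T) (fun c => α + β < c) (fun c => c - β) ?_ ?_ p
    (fun c => κ c * if α + β < c then 1 / 2 else 1) hp ?_
  · refine (mul_le_mul_of_nonneg_left h2 (by positivity)).trans (le_of_eq ?_)
    rw [← mul_assoc, mul_comm ((2 : ℝ) ^ (L - β))]
    congr 1
    refine prod_congr rfl fun c _ => ?_
    split_ifs <;> ring
  · intro a ha b hb h
    simp only [Set.mem_ofPred_eq] at ha hb h
    omega
  · intro c hc h
    have := mem_range.1 hc
    omega
  · intro c
    refine mul_nonneg (hκ c) ?_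
    split_ifs <;> norm_num

/-- The indicator of `T` not being a sum of an element of `Z.1` and one of `Z.2`. -/
def notSum (T : ℕ) (Z : Finset ℕ × Finset ℕ) : ℝ :=
  if ∀ a ∈ Z.1, ∀ b ∈ Z.2, a + b ≠ T then 1 else 0

lemma notSum_nonneg (T : ℕ) (Z : Finset ℕ × Finset ℕ) : 0 ≤ notSum T Z := by
  unfold notSum; split_ifs <;> norm_num

lemma notSum_mul_self (T : ℕ) (Z : Finset ℕ × Finset ℕ) :
    notSum T Z * notSum T Z = notSum T Z := by
  unfold notSum; split_ifs <;> norm_num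

/-- The representations `T = (c - β) + (T + β - c)` with `α + β < c < T` use disjoint pairs of
coins, and each is absent with probability `3/4`. -/
lemma sum_notSum_le (L α β T : ℕ) (hT : T ≤ L) :
    ∑ Z ∈ pairEnvelope L α β, notSum T Z ≤
      2 ^ (L - α) * 2 ^ (L - β) * ∏ c ∈ range T, if α + β < c then (3 / 4 : ℝ) else 1 := by
  rw [pairEnvelope, sum_product]
  have h1 : ∀ X ∈ envelope L α, ∑ Y ∈ envelope L β, notSum T (X, Y) ≤
      2 ^ (L - β) * ∏ c ∈ range T, ((if α + β < c then (1 / 2 : ℝ) else 1) +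
        (if α + β < c then 1 / 2 else 0) * if α + β < c ∧ c - β ∈ X then 0 else 1) := by
    intro X _
    have := sum_envelope_prod_le L β (range T) (fun c => α + β < c) (fun c => T + β - c) ?_ ?_
      (fun c => if α + β < c ∧ c - β ∈ X then 0 else 1)
      (fun c => if α + β < c ∧ c - β ∈ X then 1 else 0)
      (fun c => by split_ifs <;> norm_num) (fun c => by split_ifs <;> norm_num)
    · refine le_trans (sum_le_sum fun Y _ => ?_) (this.trans (le_of_eq ?_))
      · unfold notSum
        split_ifs with h
        · refine le_of_eq (prod_eq_one fun c hc => ?_).symm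
          have hcT := mem_range.1 hc
          by_cases h1 : α + β < c ∧ c - β ∈ X
          · have h2 : T + β - c ∉ Y := fun h2 => h _ h1.2 _ h2 (by omega)
            simp [h1, h2]
          · simp [h1]
        · refine prod_nonneg fun c _ => ?_
          split_ifs <;> norm_num
      · congr 1
        refine prod_congr rfl fun c _ => ?_
        by_cases h1 : α + β < c <;> by_cases h2 : c - β ∈ X <;> simp [h1, h2]
        norm_num
    · intro a ha b hb h
      simp only [Set.mem_ofPred_eq, mem_range] at ha hb h
      omega
    · intro c hc h
      have := mem_range.1 hc
      omega
  refine (sum_le_sum h1).trans ?_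
  rw [← mul_sum]
  have h2 := sum_envelope_prod_le L α (range T) (fun c => α + β < c) (fun c => c - β) ?_ ?_
    (fun c => if α + β < c then (1 / 2 : ℝ) else 1) (fun c => if α + β < c then 1 / 2 else 0)
    (fun c => by split_ifs <;> norm_num) (fun c => by split_ifs <;> norm_num)
  · refine (mul_le_mul_of_nonneg_left h2 (by positivity)).trans (le_of_eq ?_)
    rw [← mul_assoc, mul_comm ((2 : ℝ) ^ (L - β))]
    congr 1
    refine prod_congr rfl fun c _ => ?_
    split_ifs <;> norm_num
  · intro a ha b hb h
    simp only [Set.mem_ofPred_eq] at ha hb h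
    omega
  · intro c hc h
    have := mem_range.1 hc
    omega

/-! ### Exponential moment of the number of unblocked positions. -/

/-- The elements of `{0, …, L - 1}` that are, for no `i`, a sum of an element of `Zᵢ.1` and one of
`Zᵢ.2`. -/
def unblocked (L : ℕ) (Z₁ Z₂ Z₃ : Finset ℕ × Finset ℕ) : Finset ℕ :=
  (range L).filter fun c => (∀ a ∈ Z₁.1, ∀ b ∈ Z₁.2, a + b ≠ c) ∧
    (∀ a ∈ Z₂.1, ∀ b ∈ Z₂.2, a + b ≠ c) ∧ ∀ a ∈ Z₃.1, ∀ b ∈ Z₃.2, a + b ≠ c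

/-- The term with `T` the maximum of `U` already suffices. -/
lemma pow_card_le_one_add_sum (U : Finset ℕ) :
    (8 : ℝ) ^ #U ≤ 1 + 8 * ∑ T ∈ U, 8 ^ #(U ∩ range T) := by
  rcases U.eq_empty_or_nonempty with rfl | hU
  · simp
  · have hm := U.max'_mem hU
    have hcard : #U = #(U ∩ range (U.max' hU)) + 1 := by
      have : U ∩ range (U.max' hU) = U.erase (U.max' hU) := by
        ext a
        simp only [mem_inter, mem_range, mem_erase]
        constructor
        · rintro ⟨h1, h2⟩; exact ⟨h2.ne, h1⟩
        · rintro ⟨h1, h2⟩; exact ⟨h2, lt_of_le_of_ne (le_max' _ _ h2) h1⟩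
      rw [this, card_erase_add_one hm]
    have h1 : (8 : ℝ) ^ #(U ∩ range (U.max' hU)) ≤ ∑ T ∈ U, 8 ^ #(U ∩ range T) :=
      single_le_sum (f := fun T => (8 : ℝ) ^ #(U ∩ range T)) (fun _ _ => by positivity) hm
    rw [hcard, pow_succ]
    linarith

lemma freeAt_eq_one {L α β c : ℕ} {Z : Finset ℕ × Finset ℕ} (hZ : Z ∈ pairEnvelope L α β)
    (hc : c < L) (h : ∀ a ∈ Z.1, ∀ b ∈ Z.2, a + b ≠ c) : freeAt α β Z c = 1 := by
  obtain ⟨h1, h2⟩ := mem_product.1 hZ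
  rw [mem_envelope] at h1 h2
  unfold freeAt
  rw [if_neg, if_neg, one_mul]
  · rintro ⟨hlt, hmem⟩
    -- `α + β < c < L` forces `α < L`, so `α` is a genuine element and not the default value of
    -- `lowest`.
    have := lowest_mem (L := L) (X := Z.1) (by omega)
    rw [h1.2] at this
    exact h _ this _ hmem (by omega)
  · rintro ⟨hlt, hmem⟩
    have := lowest_mem (L := L) (X := Z.2) (by omega)
    rw [h2.2] at this
    exact h _ hmem _ this (by omega)

lemma pow_card_inter_sq_le {L α₁ β₁ α₂ β₂ α₃ β₃ T : ℕ} {Z₁ Z₂ Z₃ : Finset ℕ × Finset ℕ}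
    (h₁ : Z₁ ∈ pairEnvelope L α₁ β₁) (h₂ : Z₂ ∈ pairEnvelope L α₂ β₂)
    (h₃ : Z₃ ∈ pairEnvelope L α₃ β₃) (hT : T ≤ L) :
    ((8 : ℝ) ^ #(unblocked L Z₁ Z₂ Z₃ ∩ range T)) ^ 2 ≤ ∏ c ∈ range T,
      (1 + 63 * freeAt α₁ β₁ Z₁ c * freeAt α₂ β₂ Z₂ c * freeAt α₃ β₃ Z₃ c) := by
  have e : ((8 : ℝ) ^ #(unblocked L Z₁ Z₂ Z₃ ∩ range T)) ^ 2 =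
      ∏ c ∈ range T, if c ∈ unblocked L Z₁ Z₂ Z₃ then (64 : ℝ) else 1 := by
    rw [prod_ite, prod_const, prod_const_one, mul_one, filter_mem_eq_inter, inter_comm,
      ← pow_mul, mul_comm, pow_mul]
    norm_num
  rw [e]
  refine prod_le_prod (fun c _ => by split_ifs <;> norm_num) fun c hc => ?_
  have hcL : c < L := (mem_range.1 hc).trans_le hT
  split_ifs with h
  · obtain ⟨-, g₁, g₂, g₃⟩ := mem_filter.1 h
    rw [freeAt_eq_one h₁ hcL g₁, freeAt_eq_one h₂ hcL g₂, freeAt_eq_one h₃ hcL g₃]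
    norm_num
  · have := freeAt_nonneg α₁ β₁ Z₁ c
    have := freeAt_nonneg α₂ β₂ Z₂ c
    have := freeAt_nonneg α₃ β₃ Z₃ c
    have : 0 ≤ 63 * freeAt α₁ β₁ Z₁ c * freeAt α₂ β₂ Z₂ c * freeAt α₃ β₃ Z₃ c := by positivity
    linarith

/-- The distance of two natural numbers. -/
def gap (a b : ℕ) : ℕ := (a - b) + (b - a)

/-- Below `τ` the missing factors 2 give more than the required decay. Above it the position `c = τ`
still counts 2, and the constant 3 absorbs this: `2 * 40 / 39 < 3`. -/
lemma prod_range_two_le (τ T : ℕ) :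
    ∏ c ∈ range T, (2 * if τ < c then (39 / 80 : ℝ) else 1) ≤
      3 * 2 ^ τ * (39 / 40) ^ gap T τ := by
  have low : ∀ T, T ≤ τ + 1 → ∏ c ∈ range T, (2 * if τ < c then (39 / 80 : ℝ) else 1) = 2 ^ T := by
    intro T hT
    rw [prod_congr rfl (g := fun _ => (2 : ℝ)), prod_const, card_range]
    intro c hc
    have := mem_range.1 hc
    rw [if_neg (by omega)]; norm_num
  rcases le_or_gt T τ with h | h
  · obtain ⟨m, rfl⟩ := Nat.exists_eq_add_of_le h
    have : gap T (T + m) = m := by unfold gap; omega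
    rw [low T (by omega), this, pow_add]
    have h1 : (1 : ℝ) ≤ (2 * (39 / 40)) ^ m := one_le_pow₀ (by norm_num)
    rw [mul_pow] at h1
    have h2 : (0 : ℝ) < 2 ^ T := by positivity
    nlinarith
  · obtain ⟨m, rfl⟩ := Nat.exists_eq_add_of_lt h
    have : gap (τ + m + 1) τ = m + 1 := by unfold gap; omega
    rw [this]
    clear h this
    induction m with
    | zero =>
      rw [low _ (by omega)]
      have h2 : (0 : ℝ) < 2 ^ τ := by positivity
      rw [pow_succ]; norm_num; nlinarith
    | succ m ih =>
      rw [show τ + (m + 1) + 1 = (τ + m + 1) + 1 by ring, prod_range_succ, if_pos (by omega),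
        pow_succ _ (m + 1)]
      linarith

lemma two_pow_sub_mul_prod_le {L α β : ℕ} (hα : α ≤ L) (hβ : β ≤ L) (T : ℕ) :
    (2 : ℝ) ^ (L - α) * 2 ^ (L - β) *
      ∏ c ∈ range T, (2 * if α + β < c then (39 / 80 : ℝ) else 1) ≤
    3 * 4 ^ L * (39 / 40) ^ gap T (α + β) := by
  refine (mul_le_mul_of_nonneg_left (prod_range_two_le (α + β) T) (by positivity)).trans
    (le_of_eq ?_)
  have h1 : (2 : ℝ) ^ (L - α) * 2 ^ (L - β) * 2 ^ (α + β) = 4 ^ L := by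
    rw [← pow_add, ← pow_add, show L - α + (L - β) + (α + β) = 2 * L by omega, pow_mul]
    norm_num
  rw [← h1]; ring

lemma two_pow_sub_mul_le {L α β : ℕ} (hα : α ≤ L) (hβ : β ≤ L) :
    (2 : ℝ) ^ (L - α) * 2 ^ (L - β) ≤ 4 ^ L * (39 / 40) ^ gap 0 (α + β) := by
  have h1 : (2 : ℝ) ^ (L - α) * 2 ^ (L - β) * 2 ^ (α + β) = 4 ^ L := by
    rw [← pow_add, ← pow_add, show L - α + (L - β) + (α + β) = 2 * L by omega, pow_mul]
    norm_num
  rw [← h1, show gap 0 (α + β) = α + β by unfold gap; omega, mul_assoc, ← mul_pow]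
  refine le_mul_of_one_le_right (by positivity) (one_le_pow₀ (by norm_num))

/-- Each factor is affine in each `freeAt`, so the three pairs can be averaged out one after
another. -/
lemma sum_pairs_prod_freeAt_le (L α₁ β₁ α₂ β₂ α₃ β₃ T : ℕ) (hT : T ≤ L) :
    ∑ Z₁ ∈ pairEnvelope L α₁ β₁, ∑ Z₂ ∈ pairEnvelope L α₂ β₂, ∑ Z₃ ∈ pairEnvelope L α₃ β₃,
      ∏ c ∈ range T, (1 + 63 * freeAt α₁ β₁ Z₁ c * freeAt α₂ β₂ Z₂ c * freeAt α₃ β₃ Z₃ c) ≤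
    2 ^ (L - α₁) * 2 ^ (L - β₁) * (2 ^ (L - α₂) * 2 ^ (L - β₂)) *
      (2 ^ (L - α₃) * 2 ^ (L - β₃)) * ∏ c ∈ range T,
      (1 + 63 * (if α₁ + β₁ < c then 1 / 4 else 1) * (if α₂ + β₂ < c then 1 / 4 else 1) *
        if α₃ + β₃ < c then 1 / 4 else 1) := by
  have hq : ∀ (P : Prop) [Decidable P], (0 : ℝ) ≤ if P then 1 / 4 else 1 := by
    intro P _; split_ifs <;> norm_num
  have s3 : ∀ Z₁ Z₂, ∑ Z₃ ∈ pairEnvelope L α₃ β₃, ∏ c ∈ range T,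
      (1 + 63 * freeAt α₁ β₁ Z₁ c * freeAt α₂ β₂ Z₂ c * freeAt α₃ β₃ Z₃ c) ≤
      2 ^ (L - α₃) * 2 ^ (L - β₃) * ∏ c ∈ range T, (1 + (63 * freeAt α₁ β₁ Z₁ c *
        if α₃ + β₃ < c then 1 / 4 else 1) * freeAt α₂ β₂ Z₂ c) := by
    intro Z₁ Z₂
    refine (sum_pairEnvelope_prod_le L α₃ β₃ T hT (fun _ => 1)
      (fun c => 63 * freeAt α₁ β₁ Z₁ c * freeAt α₂ β₂ Z₂ c) (fun _ => zero_le_one) ?_).trans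
      (le_of_eq ?_)
    · intro c
      exact mul_nonneg (mul_nonneg (by norm_num) (freeAt_nonneg _ _ _ _)) (freeAt_nonneg _ _ _ _)
    · congr 1; refine prod_congr rfl fun c _ => ?_; ring
  have s2 : ∀ Z₁, ∑ Z₂ ∈ pairEnvelope L α₂ β₂, ∏ c ∈ range T, (1 + (63 * freeAt α₁ β₁ Z₁ c *
        if α₃ + β₃ < c then 1 / 4 else 1) * freeAt α₂ β₂ Z₂ c) ≤
      2 ^ (L - α₂) * 2 ^ (L - β₂) * ∏ c ∈ range T, (1 + (63 *
        (if α₂ + β₂ < c then 1 / 4 else 1) * if α₃ + β₃ < c then 1 / 4 else 1) *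
          freeAt α₁ β₁ Z₁ c) := by
    intro Z₁
    refine (sum_pairEnvelope_prod_le L α₂ β₂ T hT (fun _ => 1)
      (fun c => 63 * freeAt α₁ β₁ Z₁ c * if α₃ + β₃ < c then 1 / 4 else 1)
      (fun _ => zero_le_one) ?_).trans (le_of_eq ?_)
    · intro c
      exact mul_nonneg (mul_nonneg (by norm_num) (freeAt_nonneg _ _ _ _)) (hq _)
    · congr 1; refine prod_congr rfl fun c _ => ?_; ring
  have s1 := sum_pairEnvelope_prod_le L α₁ β₁ T hT (fun _ => 1) (fun c => 63 *
        (if α₂ + β₂ < c then 1 / 4 else 1) * if α₃ + β₃ < c then 1 / 4 else 1)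
        (fun _ => zero_le_one) (fun c => mul_nonneg (mul_nonneg (by norm_num) (hq _)) (hq _))
  calc _ ≤ ∑ Z₁ ∈ pairEnvelope L α₁ β₁, ∑ Z₂ ∈ pairEnvelope L α₂ β₂,
        2 ^ (L - α₃) * 2 ^ (L - β₃) * ∏ c ∈ range T, (1 + (63 * freeAt α₁ β₁ Z₁ c *
        if α₃ + β₃ < c then 1 / 4 else 1) * freeAt α₂ β₂ Z₂ c) :=
        sum_le_sum fun Z₁ _ => sum_le_sum fun Z₂ _ => s3 Z₁ Z₂
    _ = 2 ^ (L - α₃) * 2 ^ (L - β₃) * ∑ Z₁ ∈ pairEnvelope L α₁ β₁,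
        ∑ Z₂ ∈ pairEnvelope L α₂ β₂, ∏ c ∈ range T, (1 + (63 * freeAt α₁ β₁ Z₁ c *
        if α₃ + β₃ < c then 1 / 4 else 1) * freeAt α₂ β₂ Z₂ c) := by
        simp_rw [← mul_sum]
    _ ≤ 2 ^ (L - α₃) * 2 ^ (L - β₃) * ∑ Z₁ ∈ pairEnvelope L α₁ β₁, (2 ^ (L - α₂) *
        2 ^ (L - β₂) * ∏ c ∈ range T, (1 + (63 *
        (if α₂ + β₂ < c then 1 / 4 else 1) * if α₃ + β₃ < c then 1 / 4 else 1) *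
          freeAt α₁ β₁ Z₁ c)) := by
        gcongr with Z₁ _; exact s2 Z₁
    _ = 2 ^ (L - α₃) * 2 ^ (L - β₃) * (2 ^ (L - α₂) *
        2 ^ (L - β₂)) * ∑ Z₁ ∈ pairEnvelope L α₁ β₁, ∏ c ∈ range T, (1 + (63 *
        (if α₂ + β₂ < c then 1 / 4 else 1) * if α₃ + β₃ < c then 1 / 4 else 1) *
          freeAt α₁ β₁ Z₁ c) := by
        rw [← mul_sum]; ring
    _ ≤ _ := mul_le_mul_of_nonneg_left s1 (by positivity)
    _ = _ := by
        have : ∀ c ∈ range T, ((1 : ℝ) + 63 * (if α₂ + β₂ < c then 1 / 4 else 1) *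
            (if α₃ + β₃ < c then 1 / 4 else 1) * if α₁ + β₁ < c then 1 / 4 else 1) =
            (1 + 63 * (if α₁ + β₁ < c then 1 / 4 else 1) *
            (if α₂ + β₂ < c then 1 / 4 else 1) * if α₃ + β₃ < c then 1 / 4 else 1) :=
          fun c _ => by ring
        rw [prod_congr rfl this]
        ring

lemma sum_pairs_notSum_mul_pow_le {L α₁ β₁ α₂ β₂ α₃ β₃ : ℕ} (hα₁ : α₁ ≤ L) (hβ₁ : β₁ ≤ L)
    (hα₂ : α₂ ≤ L) (hβ₂ : β₂ ≤ L) (hα₃ : α₃ ≤ L) (hβ₃ : β₃ ≤ L) (T : ℕ) (hT : T ≤ L) :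
    ∑ Z₁ ∈ pairEnvelope L α₁ β₁, ∑ Z₂ ∈ pairEnvelope L α₂ β₂, ∑ Z₃ ∈ pairEnvelope L α₃ β₃,
      notSum T Z₁ * notSum T Z₂ * notSum T Z₃ * 8 ^ #(unblocked L Z₁ Z₂ Z₃ ∩ range T) ≤
    27 * 64 ^ L * ((39 / 40) ^ gap T (α₁ + β₁) * (39 / 40) ^ gap T (α₂ + β₂) *
      (39 / 40) ^ gap T (α₃ + β₃)) := by
  set A := pairEnvelope L α₁ β₁
  set B := pairEnvelope L α₂ β₂
  set C := pairEnvelope L α₃ β₃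
  set N : ℝ := 2 ^ (L - α₁) * 2 ^ (L - β₁) * (2 ^ (L - α₂) * 2 ^ (L - β₂)) *
      (2 ^ (L - α₃) * 2 ^ (L - β₃)) with hN
  have hN0 : 0 ≤ N := by positivity
  -- The two kinds of events share coins. Cauchy–Schwarz separates them, turning `8` into `64 = 1 +
  -- 63`.
  have cs := sum_mul_sq_le_sq_mul_sq (A ×ˢ B ×ˢ C)
    (fun Z => notSum T Z.1 * notSum T Z.2.1 * notSum T Z.2.2)
    (fun Z => (8 : ℝ) ^ #(unblocked L Z.1 Z.2.1 Z.2.2 ∩ range T))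
  simp only [sum_product] at cs
  have i1 : ∑ Z₁ ∈ A, ∑ Z₂ ∈ B, ∑ Z₃ ∈ C, (notSum T Z₁ * notSum T Z₂ * notSum T Z₃) ^ 2 ≤
      N * ∏ c ∈ range T, ((if α₁ + β₁ < c then (3 / 4 : ℝ) else 1) *
        (if α₂ + β₂ < c then 3 / 4 else 1) * if α₃ + β₃ < c then 3 / 4 else 1) := by
    have e : ∀ Z₁ Z₂ Z₃, (notSum T Z₁ * notSum T Z₂ * notSum T Z₃) ^ 2 =
        notSum T Z₁ * (notSum T Z₂ * notSum T Z₃) := by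
      intro Z₁ Z₂ Z₃
      rw [sq]
      calc _ = notSum T Z₁ * notSum T Z₁ * ((notSum T Z₂ * notSum T Z₂) *
            (notSum T Z₃ * notSum T Z₃)) := by ring
        _ = _ := by simp only [notSum_mul_self]
    simp_rw [e, ← mul_sum]
    rw [← sum_mul, ← sum_mul]
    have n0 : ∀ D : Finset (Finset ℕ × Finset ℕ), 0 ≤ ∑ Z ∈ D, notSum T Z :=
      fun D => sum_nonneg fun Z _ => notSum_nonneg T Z
    have p0 : ∀ τ, 0 ≤ ∏ c ∈ range T, if τ < c then (3 / 4 : ℝ) else 1 :=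
      fun τ => prod_nonneg fun c _ => by split_ifs <;> norm_num
    refine (mul_le_mul (sum_notSum_le L α₁ β₁ T hT) (mul_le_mul (sum_notSum_le L α₂ β₂ T hT)
      (sum_notSum_le L α₃ β₃ T hT) (n0 _) (mul_nonneg (by positivity) (p0 _)))
      (mul_nonneg (n0 _) (n0 _)) (mul_nonneg (by positivity) (p0 _))).trans (le_of_eq ?_)
    rw [prod_mul_distrib, prod_mul_distrib, hN]
    ring
  have i2 : ∑ Z₁ ∈ A, ∑ Z₂ ∈ B, ∑ Z₃ ∈ C, ((8 : ℝ) ^ #(unblocked L Z₁ Z₂ Z₃ ∩ range T)) ^ 2 ≤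
      N * ∏ c ∈ range T, (1 + 63 * (if α₁ + β₁ < c then 1 / 4 else 1) *
        (if α₂ + β₂ < c then 1 / 4 else 1) * if α₃ + β₃ < c then 1 / 4 else 1) :=
    (sum_le_sum fun Z₁ h₁ => sum_le_sum fun Z₂ h₂ => sum_le_sum fun Z₃ h₃ =>
      pow_card_inter_sq_le h₁ h₂ h₃ hT).trans
      (sum_pairs_prod_freeAt_le L α₁ β₁ α₂ β₂ α₃ β₃ T hT)
  set ν : ℕ → ℕ → ℝ := fun τ c => 2 * if τ < c then (39 / 80 : ℝ) else 1 with hν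
  have ν0 : ∀ τ, 0 ≤ ∏ c ∈ range T, ν τ c :=
    fun τ => prod_nonneg fun c _ => by simp only [hν]; split_ifs <;> norm_num
  have cell : (∏ c ∈ range T, ((if α₁ + β₁ < c then (3 / 4 : ℝ) else 1) *
        (if α₂ + β₂ < c then 3 / 4 else 1) * if α₃ + β₃ < c then 3 / 4 else 1)) *
      ∏ c ∈ range T, (1 + 63 * (if α₁ + β₁ < c then 1 / 4 else 1) *
        (if α₂ + β₂ < c then 1 / 4 else 1) * if α₃ + β₃ < c then 1 / 4 else 1) ≤
      ((∏ c ∈ range T, ν (α₁ + β₁) c) * (∏ c ∈ range T, ν (α₂ + β₂) c) *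
        ∏ c ∈ range T, ν (α₃ + β₃) c) ^ 2 := by
    rw [← prod_mul_distrib, ← prod_mul_distrib, ← prod_mul_distrib, ← prod_pow]
    refine prod_le_prod (fun c _ => ?_) fun c _ => ?_
    · split_ifs <;> norm_num
    · simp only [hν]
      -- If `r` of the thresholds lie below `c`, this is `(3/4)^r * (1 + 63/4^r) ≤ 64 *
      -- (39/80)^(2r)`. Equality holds at `r = 0`; the tightest other case, `r = 3`, is where a
      -- constant below `1/2` must be affordable.
      split_ifs <;> norm_num
  have fin : N * ((∏ c ∈ range T, ν (α₁ + β₁) c) * (∏ c ∈ range T, ν (α₂ + β₂) c) *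
        ∏ c ∈ range T, ν (α₃ + β₃) c) ≤ 27 * 64 ^ L * ((39 / 40) ^ gap T (α₁ + β₁) *
        (39 / 40) ^ gap T (α₂ + β₂) * (39 / 40) ^ gap T (α₃ + β₃)) := by
    have f1 := two_pow_sub_mul_prod_le hα₁ hβ₁ T
    have f2 := two_pow_sub_mul_prod_le hα₂ hβ₂ T
    have f3 := two_pow_sub_mul_prod_le hα₃ hβ₃ T
    have := mul_le_mul (mul_le_mul f1 f2 (mul_nonneg (by positivity) (ν0 _)) (by positivity)) f3
      (mul_nonneg (by positivity) (ν0 _)) (by positivity)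
    refine le_trans (le_of_eq ?_) (this.trans (le_of_eq ?_))
    · simp only [hN, hν]; ring
    · rw [show (64 : ℝ) = 4 * 4 * 4 by norm_num, mul_pow, mul_pow]; ring
  refine le_trans ?_ fin
  refine le_of_sq_le_sq ?_ (mul_nonneg hN0 (mul_nonneg (mul_nonneg (ν0 _) (ν0 _)) (ν0 _)))
  refine cs.trans ((mul_le_mul i1 i2 ?_ ?_).trans ?_)
  · exact sum_nonneg fun _ _ => sum_nonneg fun _ _ => sum_nonneg fun _ _ => by positivity
  · exact mul_nonneg hN0 (prod_nonneg fun c _ => by split_ifs <;> norm_num)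
  · rw [mul_pow, sq N]
    calc _ = N * N * ((∏ c ∈ range T, ((if α₁ + β₁ < c then (3 / 4 : ℝ) else 1) *
        (if α₂ + β₂ < c then 3 / 4 else 1) * if α₃ + β₃ < c then 3 / 4 else 1)) *
        ∏ c ∈ range T, (1 + 63 * (if α₁ + β₁ < c then 1 / 4 else 1) *
        (if α₂ + β₂ < c then 1 / 4 else 1) * if α₃ + β₃ < c then 1 / 4 else 1)) := by ring
      _ ≤ _ := mul_le_mul_of_nonneg_left cell (by positivity)

lemma sum_pairs_pow_card_unblocked_le {L α₁ β₁ α₂ β₂ α₃ β₃ : ℕ} (hα₁ : α₁ ≤ L) (hβ₁ : β₁ ≤ L)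
    (hα₂ : α₂ ≤ L) (hβ₂ : β₂ ≤ L) (hα₃ : α₃ ≤ L) (hβ₃ : β₃ ≤ L) :
    ∑ Z₁ ∈ pairEnvelope L α₁ β₁, ∑ Z₂ ∈ pairEnvelope L α₂ β₂, ∑ Z₃ ∈ pairEnvelope L α₃ β₃,
      (8 : ℝ) ^ #(unblocked L Z₁ Z₂ Z₃) ≤
    217 * 64 ^ L * ∑ T ∈ range (L + 1), ((39 / 40) ^ gap T (α₁ + β₁) *
      (39 / 40) ^ gap T (α₂ + β₂) * (39 / 40) ^ gap T (α₃ + β₃)) := by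
  set A := pairEnvelope L α₁ β₁
  set B := pairEnvelope L α₂ β₂
  set C := pairEnvelope L α₃ β₃
  set w : ℕ → ℝ := fun T => (39 / 40) ^ gap T (α₁ + β₁) *
      (39 / 40) ^ gap T (α₂ + β₂) * (39 / 40) ^ gap T (α₃ + β₃) with hw
  have w0 : ∀ T, 0 ≤ w T := fun T => by simp only [hw]; positivity
  have point : ∀ Z₁ Z₂ Z₃, (8 : ℝ) ^ #(unblocked L Z₁ Z₂ Z₃) ≤ 1 + 8 * ∑ T ∈ range L,
      notSum T Z₁ * notSum T Z₂ * notSum T Z₃ * 8 ^ #(unblocked L Z₁ Z₂ Z₃ ∩ range T) := by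
    intro Z₁ Z₂ Z₃
    refine (pow_card_le_one_add_sum _).trans ?_
    gcongr
    have : ∑ T ∈ unblocked L Z₁ Z₂ Z₃, (8 : ℝ) ^ #(unblocked L Z₁ Z₂ Z₃ ∩ range T) =
        ∑ T ∈ unblocked L Z₁ Z₂ Z₃, notSum T Z₁ * notSum T Z₂ * notSum T Z₃ *
          8 ^ #(unblocked L Z₁ Z₂ Z₃ ∩ range T) := by
      refine sum_congr rfl fun T hT => ?_
      obtain ⟨-, h1, h2, h3⟩ := mem_filter.1 hT
      simp only [notSum]
      rw [if_pos h1, if_pos h2, if_pos h3]; ring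
    rw [this]
    refine sum_le_sum_of_subset_of_nonneg (filter_subset _ _) fun T _ _ => ?_
    have := notSum_nonneg T Z₁
    have := notSum_nonneg T Z₂
    have := notSum_nonneg T Z₃
    positivity
  have card : (∑ Z₁ ∈ A, ∑ Z₂ ∈ B, ∑ Z₃ ∈ C, (1 : ℝ)) ≤ 64 ^ L * w 0 := by
    have hc : ∀ {α β : ℕ}, α ≤ L → β ≤ L →
        (#(pairEnvelope L α β) : ℝ) ≤ 4 ^ L * (39 / 40) ^ gap 0 (α + β) := by
      intro α β hα hβ
      rw [pairEnvelope, card_product, Nat.cast_mul]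
      exact (mul_le_mul (card_envelope_le L α) (card_envelope_le L β) (by positivity)
        (by positivity)).trans (two_pow_sub_mul_le hα hβ)
    have := mul_le_mul (mul_le_mul (hc hα₁ hβ₁) (hc hα₂ hβ₂) (by positivity) (by positivity))
      (hc hα₃ hβ₃) (by positivity) (by positivity)
    refine le_trans (le_of_eq ?_) (this.trans (le_of_eq ?_))
    · simp only [sum_const, nsmul_eq_mul, mul_one]; ring
    · simp only [hw]; rw [show (64 : ℝ) = 4 * 4 * 4 by norm_num, mul_pow, mul_pow]; ring
  calc _ ≤ ∑ Z₁ ∈ A, ∑ Z₂ ∈ B, ∑ Z₃ ∈ C, (1 + 8 * ∑ T ∈ range L, notSum T Z₁ * notSum T Z₂ *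
        notSum T Z₃ * 8 ^ #(unblocked L Z₁ Z₂ Z₃ ∩ range T)) :=
        sum_le_sum fun Z₁ _ => sum_le_sum fun Z₂ _ => sum_le_sum fun Z₃ _ => point Z₁ Z₂ Z₃
    _ = (∑ Z₁ ∈ A, ∑ Z₂ ∈ B, ∑ Z₃ ∈ C, (1 : ℝ)) + 8 * ∑ T ∈ range L,
        ∑ Z₁ ∈ A, ∑ Z₂ ∈ B, ∑ Z₃ ∈ C, notSum T Z₁ * notSum T Z₂ *
        notSum T Z₃ * 8 ^ #(unblocked L Z₁ Z₂ Z₃ ∩ range T) := by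
        have e1 : ∀ Z₁ Z₂, ∑ Z₃ ∈ C, ∑ T ∈ range L, notSum T Z₁ * notSum T Z₂ *
            notSum T Z₃ * (8 : ℝ) ^ #(unblocked L Z₁ Z₂ Z₃ ∩ range T) =
            ∑ T ∈ range L, ∑ Z₃ ∈ C, notSum T Z₁ * notSum T Z₂ *
            notSum T Z₃ * 8 ^ #(unblocked L Z₁ Z₂ Z₃ ∩ range T) := fun _ _ => sum_comm
        have e2 : ∀ Z₁, ∑ Z₂ ∈ B, ∑ T ∈ range L, ∑ Z₃ ∈ C, notSum T Z₁ * notSum T Z₂ *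
            notSum T Z₃ * (8 : ℝ) ^ #(unblocked L Z₁ Z₂ Z₃ ∩ range T) =
            ∑ T ∈ range L, ∑ Z₂ ∈ B, ∑ Z₃ ∈ C, notSum T Z₁ * notSum T Z₂ *
            notSum T Z₃ * 8 ^ #(unblocked L Z₁ Z₂ Z₃ ∩ range T) := fun _ => sum_comm
        simp_rw [sum_add_distrib, ← mul_sum]
        simp_rw [e1, e2]
        congr 2
        exact sum_comm
    _ ≤ 64 ^ L * w 0 + 8 * ∑ T ∈ range L, 27 * 64 ^ L * w T := by
        refine add_le_add card (mul_le_mul_of_nonneg_left (sum_le_sum fun T hT => ?_) (by norm_num))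
        exact sum_pairs_notSum_mul_pow_le hα₁ hβ₁ hα₂ hβ₂ hα₃ hβ₃ T (mem_range.1 hT).le
    _ ≤ 64 ^ L * ∑ T ∈ range (L + 1), w T + 8 * (27 * 64 ^ L * ∑ T ∈ range (L + 1), w T) := by
        rw [← mul_sum]
        have h1 : w 0 ≤ ∑ T ∈ range (L + 1), w T :=
          single_le_sum (f := w) (fun T _ => w0 T) (by simp)
        have h2 : ∑ T ∈ range L, w T ≤ ∑ T ∈ range (L + 1), w T := by
          rw [sum_range_succ]; linarith [w0 L]
        gcongr
    _ = _ := by ring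

lemma sum_range_pow_gap_le (M τ : ℕ) : ∑ T ∈ range M, (499 / 500 : ℝ) ^ gap T τ ≤ 1000 := by
  have hg : ∀ m, ∑ j ∈ range m, (499 / 500 : ℝ) ^ j ≤ 500 := fun m => by
    have : (0 : ℝ) ≤ (499 / 500) ^ m := by positivity
    rw [geom_sum_eq (by norm_num), div_le_iff_of_neg (by norm_num)]
    linarith
  calc ∑ T ∈ range M, (499 / 500 : ℝ) ^ gap T τ
      ≤ ∑ T ∈ range (τ + M), (499 / 500 : ℝ) ^ gap T τ :=
        sum_le_sum_of_subset_of_nonneg (range_mono (by omega)) fun _ _ _ => by positivity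
    _ = ∑ j ∈ range τ, (499 / 500 : ℝ) ^ gap (τ - 1 - j) τ +
        ∑ j ∈ range M, (499 / 500 : ℝ) ^ gap (τ + j) τ := by
        rw [sum_range_add, sum_range_reflect (fun j => (499 / 500 : ℝ) ^ gap j τ) τ]
    _ ≤ ∑ j ∈ range τ, (499 / 500 : ℝ) ^ j + ∑ j ∈ range M, (499 / 500 : ℝ) ^ j := by
        refine add_le_add (sum_le_sum fun j hj => ?_) (sum_le_sum fun j _ => ?_) <;>
        refine pow_le_pow_of_le_one (by norm_num) (by norm_num) ?_
        · have := mem_range.1 hj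
          unfold gap; omega
        · unfold gap; omega
    _ ≤ 1000 := by linarith [hg τ, hg M]

/-- Triangle inequality through `T`; the spare multiple of `gap T a` keeps the sum over `T`
convergent. -/
lemma gap_add_gap_le (a b c T : ℕ) :
    3 * (gap a b + gap a c) + 6 * gap T a ≤ 12 * (gap T a + gap T b + gap T c) := by
  unfold gap; omega

lemma sum_pairs_pow_card_unblocked_le_gap {L α₁ β₁ α₂ β₂ α₃ β₃ : ℕ} (hα₁ : α₁ ≤ L) (hβ₁ : β₁ ≤ L)
    (hα₂ : α₂ ≤ L) (hβ₂ : β₂ ≤ L) (hα₃ : α₃ ≤ L) (hβ₃ : β₃ ≤ L) :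
    ∑ Z₁ ∈ pairEnvelope L α₁ β₁, ∑ Z₂ ∈ pairEnvelope L α₂ β₂, ∑ Z₃ ∈ pairEnvelope L α₃ β₃,
      (8 : ℝ) ^ #(unblocked L Z₁ Z₂ Z₃) ≤
    (61 * 4 ^ L * (499 / 500) ^ (gap (α₁ + β₁) (α₂ + β₂) + gap (α₁ + β₁) (α₃ + β₃))) ^ 3 := by
  refine (sum_pairs_pow_card_unblocked_le hα₁ hβ₁ hα₂ hβ₂ hα₃ hβ₃).trans ?_
  generalize α₁ + β₁ = a
  generalize α₂ + β₂ = b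
  generalize α₃ + β₃ = c
  have h1 : ∀ T ∈ range (L + 1), ((39 / 40 : ℝ) ^ gap T a * (39 / 40) ^ gap T b *
      (39 / 40) ^ gap T c) ≤ (499 / 500) ^ (3 * (gap a b + gap a c)) * (499 / 500) ^ gap T a := by
    intro T _
    rw [← pow_add, ← pow_add, ← pow_add]
    calc (39 / 40 : ℝ) ^ (gap T a + gap T b + gap T c)
        ≤ ((499 / 500) ^ 12) ^ (gap T a + gap T b + gap T c) :=
          pow_le_pow_left₀ (by norm_num) (by norm_num) _
      _ = (499 / 500) ^ (12 * (gap T a + gap T b + gap T c)) := by rw [← pow_mul]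
      _ ≤ _ := pow_le_pow_of_le_one (by norm_num) (by norm_num) (by
          have := gap_add_gap_le a b c T; omega)
  have h2 : ∑ T ∈ range (L + 1), ((39 / 40 : ℝ) ^ gap T a * (39 / 40) ^ gap T b *
      (39 / 40) ^ gap T c) ≤ (499 / 500) ^ (3 * (gap a b + gap a c)) * 1000 := by
    refine (sum_le_sum h1).trans ?_
    rw [← mul_sum]
    exact mul_le_mul_of_nonneg_left (sum_range_pow_gap_le _ _) (by positivity)
  refine (mul_le_mul_of_nonneg_left h2 (by positivity)).trans ?_
  rw [mul_pow, mul_pow, ← pow_mul, ← pow_mul, mul_comm L 3, pow_mul 4 3 L,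
    mul_comm (gap a b + gap a c) 3]
  -- The constants fit because `217 * 1000 ≤ 61 ^ 3`.
  norm_num
  have : (0 : ℝ) ≤ 64 ^ L * (499 / 500) ^ (3 * (gap a b + gap a c)) := by positivity
  linarith

/-! ### Hölder's inequality and summation along chains. -/

lemma sum_mul_mul_le_of_sum_cube_le {ι : Type*} (s : Finset ι) (a b c : ι → ℝ) {x y z : ℝ}
    (ha : ∀ i ∈ s, 0 ≤ a i) (hb : ∀ i ∈ s, 0 ≤ b i) (hc : ∀ i ∈ s, 0 ≤ c i)
    (hx : 0 ≤ x) (hy : 0 ≤ y) (hz : 0 ≤ z)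
    (hax : ∑ i ∈ s, a i ^ 3 ≤ x ^ 3) (hby : ∑ i ∈ s, b i ^ 3 ≤ y ^ 3)
    (hcz : ∑ i ∈ s, c i ^ 3 ≤ z ^ 3) : ∑ i ∈ s, a i * b i * c i ≤ x * y * z := by
  have zero : ∀ (u : ι → ℝ) (v : ℝ), (∀ i ∈ s, 0 ≤ u i) → v = 0 → ∑ i ∈ s, u i ^ 3 ≤ v ^ 3 →
      ∀ i ∈ s, u i = 0 := by
    intro u v hu hv h i hi
    have h3 : u i ^ 3 ≤ 0 := by
      calc u i ^ 3 ≤ ∑ i ∈ s, u i ^ 3 :=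
            single_le_sum (f := fun i => u i ^ 3) (fun j hj => pow_nonneg (hu j hj) 3) hi
        _ ≤ 0 := by rw [hv] at h; simpa using h
    have := pow_nonneg (hu i hi) 3
    exact pow_eq_zero_iff (three_ne_zero) |>.1 (le_antisymm h3 this)
  have rhs0 : 0 ≤ x * y * z := by positivity
  rcases hx.eq_or_lt with hx' | hx'
  · rw [sum_eq_zero fun i hi => by rw [zero a x ha hx'.symm hax i hi]; ring]; exact rhs0
  rcases hy.eq_or_lt with hy' | hy'
  · rw [sum_eq_zero fun i hi => by rw [zero b y hb hy'.symm hby i hi]; ring]; exact rhs0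
  rcases hz.eq_or_lt with hz' | hz'
  · rw [sum_eq_zero fun i hi => by rw [zero c z hc hz'.symm hcz i hi]; ring]; exact rhs0
  have amgm : ∀ p q r : ℝ, 0 ≤ p → 0 ≤ q → 0 ≤ r → 3 * (p * q * r) ≤ p ^ 3 + q ^ 3 + r ^ 3 := by
    intro p q r hp hq hr
    nlinarith [mul_nonneg (add_nonneg (add_nonneg hp hq) hr)
      (add_nonneg (add_nonneg (sq_nonneg (p - q)) (sq_nonneg (q - r))) (sq_nonneg (r - p)))]
  have term : ∀ i ∈ s, 3 * (a i * b i * c i) ≤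
      x * y * z * (a i ^ 3 / x ^ 3 + b i ^ 3 / y ^ 3 + c i ^ 3 / z ^ 3) := by
    intro i hi
    have := amgm (a i / x) (b i / y) (c i / z) (div_nonneg (ha i hi) hx) (div_nonneg (hb i hi) hy)
      (div_nonneg (hc i hi) hz)
    rw [div_pow, div_pow, div_pow] at this
    refine le_trans (le_of_eq ?_) (mul_le_mul_of_nonneg_left this rhs0)
    field_simp
  have tot : 3 * ∑ i ∈ s, a i * b i * c i ≤ x * y * z * 3 := by
    rw [mul_sum]
    refine (sum_le_sum term).trans ?_
    rw [← mul_sum, sum_add_distrib, sum_add_distrib, ← sum_div, ← sum_div, ← sum_div]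
    refine mul_le_mul_of_nonneg_left ?_ rhs0
    have d1 := div_le_one_of_le₀ hax (by positivity)
    have d2 := div_le_one_of_le₀ hby (by positivity)
    have d3 := div_le_one_of_le₀ hcz (by positivity)
    linarith
  linarith

lemma sum_piFinset_const_succ {Ω : Type*} [DecidableEq Ω] (S : Finset Ω) (k : ℕ)
    (φ : (Fin (k + 1) → Ω) → ℝ) :
    ∑ Z ∈ Fintype.piFinset (fun _ : Fin (k + 1) => S), φ Z =
      ∑ Z ∈ Fintype.piFinset (fun _ : Fin k => S), ∑ z ∈ S, φ (Fin.cons z Z) := by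
  rw [← sum_product']
  refine sum_nbij' (fun Z => (Fin.tail Z, Z 0)) (fun p => Fin.cons p.2 p.1) ?_ ?_ ?_ ?_ ?_
  · intro Z hZ
    rw [Fintype.mem_piFinset] at hZ
    simp only [mem_product, Fintype.mem_piFinset]
    exact ⟨fun i => hZ _, hZ 0⟩
  · intro p hp
    simp only [mem_product, Fintype.mem_piFinset] at hp ⊢
    intro i
    refine Fin.cases ?_ (fun j => ?_) i
    · simpa using hp.2
    · simpa using hp.1 j
  · intro Z _; simp
  · intro p _; simp
  · intro Z _; simp

/-- A product of functions of three consecutive terms of a sequence. -/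
def chainProd {Ω : Type*} {k : ℕ} (F : Fin k → Ω → Ω → Ω → ℝ) (Z : Fin (k + 2) → Ω) : ℝ :=
  ∏ e : Fin k, F e (Z e.castSucc.castSucc) (Z e.succ.castSucc) (Z e.succ.succ)

lemma chainProd_cons {Ω : Type*} {k : ℕ} (F : Fin (k + 1) → Ω → Ω → Ω → ℝ) (z : Ω)
    (Z : Fin (k + 2) → Ω) :
    chainProd F (Fin.cons z Z) =
      F 0 z (Z 0) (Z 1) * chainProd (fun e => F e.succ) Z := by
  rw [chainProd, Fin.prod_univ_succ]
  rfl

lemma chainProd_nonneg {Ω : Type*} {k : ℕ} {F : Fin k → Ω → Ω → Ω → ℝ}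
    (hF : ∀ e x y z, 0 ≤ F e x y z) (Z : Fin (k + 2) → Ω) : 0 ≤ chainProd F Z :=
  prod_nonneg fun _ _ => hF _ _ _ _

/-- Hölder's inequality along a chain: each term of the sequence occurs in three factors. -/
lemma sum_chainProd_le {Ω : Type*} [DecidableEq Ω] (S : Finset Ω) (k : ℕ)
    (F : Fin k → Ω → Ω → Ω → ℝ) (γ : Fin k → ℝ) (a : Ω → ℝ) (b : Ω → Ω → ℝ) (α β : ℝ)
    (hF : ∀ e x y z, 0 ≤ F e x y z) (hγ : ∀ e, 0 ≤ γ e) (ha : ∀ x, 0 ≤ a x)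
    (hb : ∀ x y, 0 ≤ b x y) (hα : 0 ≤ α) (hβ : 0 ≤ β)
    (hFγ : ∀ e, ∑ x ∈ S, ∑ y ∈ S, ∑ z ∈ S, F e x y z ^ 3 ≤ γ e ^ 3)
    (haα : ∑ x ∈ S, a x ^ 3 ≤ α ^ 3) (hbβ : ∑ x ∈ S, ∑ y ∈ S, b x y ^ 3 ≤ β ^ 3) :
    ∑ Z ∈ Fintype.piFinset (fun _ : Fin (k + 2) => S), a (Z 0) * b (Z 0) (Z 1) * chainProd F Z ≤
      (#S : ℝ) ^ 2 * (α * β * ∏ e, γ e) := by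
  induction k generalizing a b α β with
  | zero =>
    have key : ∀ Z ∈ Fintype.piFinset (fun _ : Fin 2 => S),
        a (Z 0) * b (Z 0) (Z 1) * chainProd F Z ≤ α * β := by
      intro Z hZ
      rw [Fintype.mem_piFinset] at hZ
      have h1 : a (Z 0) ≤ α := by
        refine le_of_pow_le_pow_left₀ three_ne_zero hα (le_trans ?_ haα)
        exact single_le_sum (f := fun x => a x ^ 3) (fun x _ => pow_nonneg (ha x) 3) (hZ 0)
      have h2 : b (Z 0) (Z 1) ≤ β := by
        refine le_of_pow_le_pow_left₀ three_ne_zero hβ (le_trans ?_ hbβ)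
        refine le_trans ?_ (single_le_sum (f := fun x => ∑ y ∈ S, b x y ^ 3)
          (fun x _ => sum_nonneg fun y _ => pow_nonneg (hb x y) 3) (hZ 0))
        exact single_le_sum (f := fun y => b (Z 0) y ^ 3) (fun y _ => pow_nonneg (hb _ y) 3) (hZ 1)
      simp only [chainProd, univ_eq_empty, prod_empty, mul_one]
      exact mul_le_mul h1 h2 (hb _ _) hα
    refine (sum_le_card_nsmul _ _ _ key).trans (le_of_eq ?_)
    rw [Fintype.card_piFinset]
    simp [sq]
  | succ k ih =>
    -- Summing out the first term by Hölder replaces `b` and the first factor by their `ℓ³` norms in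
    -- that variable, which serve as the new boundary weights.
    set b' : Ω → ℝ := fun y => (∑ x ∈ S, b x y ^ 3) ^ (1 / 3 : ℝ) with hb'
    set F' : Ω → Ω → ℝ := fun y z => (∑ x ∈ S, F 0 x y z ^ 3) ^ (1 / 3 : ℝ) with hF'
    have nb : ∀ y, 0 ≤ ∑ x ∈ S, b x y ^ 3 := fun y => sum_nonneg fun x _ => pow_nonneg (hb x y) 3
    have nF : ∀ y z, 0 ≤ ∑ x ∈ S, F 0 x y z ^ 3 :=
      fun y z => sum_nonneg fun x _ => pow_nonneg (hF 0 x y z) 3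
    have cube : ∀ t : ℝ, 0 ≤ t → (t ^ (1 / 3 : ℝ)) ^ 3 = t := by
      intro t ht
      rw [← Real.rpow_natCast, ← Real.rpow_mul ht]; norm_num
    have nb' : ∀ y, 0 ≤ b' y := fun y => Real.rpow_nonneg (nb y) _
    have nF' : ∀ y z, 0 ≤ F' y z := fun y z => Real.rpow_nonneg (nF y z) _
    rw [sum_piFinset_const_succ]
    have step : ∀ Z : Fin (k + 2) → Ω, ∑ z ∈ S, a ((Fin.cons z Z : Fin (k + 3) → Ω) 0) *
        b ((Fin.cons z Z : Fin (k + 3) → Ω) 0) ((Fin.cons z Z : Fin (k + 3) → Ω) 1) *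
        chainProd F (Fin.cons z Z) ≤
        α * (b' (Z 0) * F' (Z 0) (Z 1) * chainProd (fun e => F e.succ) Z) := by
      intro Z
      have h0 : ∀ z : Ω, (Fin.cons z Z : Fin (k + 3) → Ω) 0 = z := fun _ => rfl
      have h1 : ∀ z : Ω, (Fin.cons z Z : Fin (k + 3) → Ω) 1 = Z 0 := fun _ => rfl
      simp_rw [h0, h1, chainProd_cons, ← mul_assoc]
      rw [← sum_mul]
      refine mul_le_mul_of_nonneg_right ?_ (chainProd_nonneg (fun e => hF e.succ) Z)
      refine sum_mul_mul_le_of_sum_cube_le S a (fun z => b z (Z 0)) (fun z => F 0 z (Z 0) (Z 1))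
        (fun _ _ => ha _) (fun _ _ => hb _ _) (fun _ _ => hF _ _ _ _) hα (nb' _) (nF' _ _) haα
        ?_ ?_
      · rw [hb', cube _ (nb _)]
      · rw [hF', cube _ (nF _ _)]
    refine (sum_le_sum fun Z _ => step Z).trans ?_
    rw [← mul_sum]
    have := ih (fun e => F e.succ) (fun e => γ e.succ) b' F' β (γ 0) (fun e => hF e.succ)
      (fun e => hγ _) nb' nF' hβ (hγ 0) (fun e => hFγ _) ?_ ?_
    · refine (mul_le_mul_of_nonneg_left this hα).trans (le_of_eq ?_)
      rw [Fin.prod_univ_succ]; ring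
    · simp_rw [hb', cube _ (nb _)]
      rwa [sum_comm]
    · simp_rw [hF', cube _ (nF _ _)]
      refine le_trans (le_of_eq ?_) (hFγ 0)
      exact (sum_congr rfl fun y _ => sum_comm).trans sum_comm

lemma sum_chainProd_le_of_sum_le {Ω : Type*} [DecidableEq Ω] (S : Finset Ω) (k : ℕ)
    (H : Ω → Ω → Ω → ℝ) (K : ℝ) (hH : ∀ x y z, 0 ≤ H x y z)
    (hK : ∀ y z, ∑ x ∈ S, H x y z ≤ K) :
    ∑ Z ∈ Fintype.piFinset (fun _ : Fin (k + 2) => S), chainProd (fun _ => H) Z ≤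
      (#S : ℝ) ^ 2 * K ^ k := by
  induction k with
  | zero =>
    simp [chainProd, Fintype.card_piFinset, sq]
  | succ k ih =>
    rw [sum_piFinset_const_succ]
    have step : ∀ Z : Fin (k + 2) → Ω, ∑ z ∈ S, chainProd (fun _ => H) (Fin.cons z Z) ≤
        K * chainProd (fun _ => H) Z := by
      intro Z
      simp_rw [chainProd_cons]
      rw [← sum_mul]
      exact mul_le_mul_of_nonneg_right (hK _ _) (chainProd_nonneg (fun _ => hH) Z)
    refine (sum_le_sum fun Z _ => step Z).trans ?_
    rw [← mul_sum]
    rcases S.eq_empty_or_nonempty with rfl | ⟨s, hs⟩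
    · have e : Fintype.piFinset (fun _ : Fin (k + 2) => (∅ : Finset Ω)) = ∅ :=
        eq_empty_of_forall_notMem fun Z hZ => notMem_empty _ (Fintype.mem_piFinset.1 hZ 0)
      simp [e]
    · have hK0 : 0 ≤ K := (sum_nonneg fun x _ => hH x s s).trans (hK s s)
      refine (mul_le_mul_of_nonneg_left ih hK0).trans (le_of_eq ?_)
      ring

/-! ### Counting chain configurations. -/

/-- The pairs of subsets of `{0, …, L - 1}`. -/
def subsetPairs (L : ℕ) : Finset (Finset ℕ × Finset ℕ) :=
  (range L).powerset ×ˢ (range L).powerset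

lemma card_subsetPairs (L : ℕ) : #(subsetPairs L) = 4 ^ L := by
  rw [subsetPairs, card_product, card_powerset, card_range, ← mul_pow]; rfl

/-- The set of positions left free in the middle of three consecutive pairs. -/
def chainFree (L : ℕ) (x y z : Finset ℕ × Finset ℕ) : Finset ℕ :=
  unblocked L y (z.1, x.2) (x.1, z.2)

/-- Sequences of `k + 2` pairs `(Xⱼ, Yⱼ)` and of `k` sets `Cⱼ` of natural numbers below `L`, such
that `Cⱼ` is disjoint from `Xⱼ + Yⱼ`, `Xⱼ₊₁ + Yⱼ₋₁` and `Xⱼ₋₁ + Yⱼ₊₁`. -/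
def chainConfigs (L k : ℕ) :
    Finset (Σ _ : Fin (k + 2) → Finset ℕ × Finset ℕ, Fin k → Finset ℕ) :=
  (Fintype.piFinset fun _ => subsetPairs L).sigma fun Z => Fintype.piFinset fun e : Fin k =>
    (chainFree L (Z e.castSucc.castSucc) (Z e.succ.castSucc) (Z e.succ.succ)).powerset

lemma card_chainConfigs (L k : ℕ) : (#(chainConfigs L k) : ℝ) =
    ∑ Z ∈ Fintype.piFinset (fun _ : Fin (k + 2) => subsetPairs L),
      chainProd (fun _ x y z => (2 : ℝ) ^ #(chainFree L x y z)) Z := by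
  rw [chainConfigs, card_sigma, Nat.cast_sum]
  refine sum_congr rfl fun Z _ => ?_
  rw [Fintype.card_piFinset, Nat.cast_prod, chainProd]
  refine prod_congr rfl fun e _ => ?_
  rw [card_powerset]; norm_num

/-- The deviation of consecutive pairs of least elements from having equal sums. -/
def deviation (x y z : ℕ × ℕ) : ℕ := gap (y.1 + y.2) (z.1 + x.2) + gap (y.1 + y.2) (x.1 + z.2)

/-- For given `y` and `z`, one gap depends only on `x.2` and the other only on `x.1`, so the sum is
a product of two geometric-type sums. -/
lemma sum_pow_deviation_le (R : ℕ) (y z : ℕ × ℕ) :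
    ∑ x ∈ range R ×ˢ range R, (499 / 500 : ℝ) ^ deviation x y z ≤ 1000000 := by
  have h : ∀ a s, ∑ f ∈ range R, (499 / 500 : ℝ) ^ gap a (s + f) ≤ 1000 := by
    intro a s
    refine le_trans ?_ (sum_range_pow_gap_le (s + R) a)
    rw [sum_range_add]
    have : ∀ f, gap a (s + f) = gap (s + f) a := fun f => by unfold gap; omega
    simp_rw [this]
    have : 0 ≤ ∑ T ∈ range s, (499 / 500 : ℝ) ^ gap T a := sum_nonneg fun _ _ => by positivity
    linarith
  rw [sum_product]
  simp_rw [deviation, pow_add]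
  have e : ∀ f, ∑ g ∈ range R, (499 / 500 : ℝ) ^ gap (y.1 + y.2) (z.1 + g) *
      (499 / 500) ^ gap (y.1 + y.2) (f + z.2) ≤
      1000 * (499 / 500) ^ gap (y.1 + y.2) (z.2 + f) := by
    intro f
    rw [← sum_mul, add_comm f]
    exact mul_le_mul_of_nonneg_right (h _ _) (by positivity)
  refine (sum_le_sum fun f _ => e f).trans ?_
  rw [← mul_sum]
  linarith [h (y.1 + y.2) z.2]

/-- The pair of least elements of a pair of sets. -/
def lowestPair (L : ℕ) (Z : Finset ℕ × Finset ℕ) : ℕ × ℕ := (lowest L Z.1, lowest L Z.2)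

lemma filter_subsetPairs (L : ℕ) (m : ℕ × ℕ) :
    (subsetPairs L).filter (fun Z => lowestPair L Z = m) = pairEnvelope L m.1 m.2 := by
  ext Z
  simp only [subsetPairs, pairEnvelope, lowestPair, mem_filter, mem_product, mem_envelope,
    mem_powerset, Prod.ext_iff]
  tauto

lemma sum_chain_cube_le (L : ℕ) (m m' m'' : ℕ × ℕ) :
    ∑ x ∈ subsetPairs L, ∑ y ∈ subsetPairs L, ∑ z ∈ subsetPairs L,
      (if lowestPair L x = m ∧ lowestPair L y = m' ∧ lowestPair L z = m'' then
        (2 : ℝ) ^ #(chainFree L x y z) else 0) ^ 3 ≤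
    (61 * 4 ^ L * (499 / 500) ^ deviation m m' m'') ^ 3 := by
  have e : ∑ x ∈ subsetPairs L, ∑ y ∈ subsetPairs L, ∑ z ∈ subsetPairs L,
      (if lowestPair L x = m ∧ lowestPair L y = m' ∧ lowestPair L z = m'' then
        (2 : ℝ) ^ #(chainFree L x y z) else 0) ^ 3 =
      ∑ x ∈ pairEnvelope L m.1 m.2, ∑ y ∈ pairEnvelope L m'.1 m'.2,
        ∑ z ∈ pairEnvelope L m''.1 m''.2, (8 : ℝ) ^ #(chainFree L x y z) := by
    simp_rw [← filter_subsetPairs, sum_filter]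
    refine sum_congr rfl fun x _ => ?_
    split_ifs with hx
    · refine sum_congr rfl fun y _ => ?_
      split_ifs with hy
      · refine sum_congr rfl fun z _ => ?_
        split_ifs with hz h h
        · rw [← pow_mul, mul_comm, pow_mul]; norm_num
        all_goals first | tauto | simp
      · exact sum_eq_zero fun z _ => by rw [if_neg (by tauto)]; norm_num
    · exact sum_eq_zero fun y _ => sum_eq_zero fun z _ => by rw [if_neg (by tauto)]; norm_num
  rw [e]
  by_cases hL : (m.1 ≤ L ∧ m.2 ≤ L) ∧ (m'.1 ≤ L ∧ m'.2 ≤ L) ∧ (m''.1 ≤ L ∧ m''.2 ≤ L)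
  · obtain ⟨⟨h1, h2⟩, ⟨h3, h4⟩, h5, h6⟩ := hL
    refine le_trans (le_of_eq ?_) (sum_pairs_pow_card_unblocked_le_gap h3 h4 h5 h2 h1 h6)
    simp_rw [← sum_product']
    -- The six sets in `x`, `y`, `z` are regrouped into the pairs whose sumsets block positions.
    refine sum_nbij' (fun p => (p.2.1, (p.2.2.1, p.1.2), (p.1.1, p.2.2.2)))
      (fun p => ((p.2.2.1, p.2.1.2), p.1, (p.2.1.1, p.2.2.2))) ?_ ?_ ?_ ?_ ?_
    · intro p hp
      simp only [mem_product, pairEnvelope] at hp ⊢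
      tauto
    · intro p hp
      simp only [mem_product, pairEnvelope] at hp ⊢
      tauto
    · intro p _; rfl
    · intro p _; rfl
    · intro p _; rfl
  · have empty : ∀ p : ℕ × ℕ, ¬ (p.1 ≤ L ∧ p.2 ≤ L) → pairEnvelope L p.1 p.2 = ∅ := by
      intro p hp
      rw [eq_empty_iff_forall_notMem]
      intro Z hZ
      rw [← filter_subsetPairs] at hZ
      have h := (mem_filter.1 hZ).2
      exact hp (h ▸ ⟨lowest_le _ _, lowest_le _ _⟩)
    have z : ∑ x ∈ pairEnvelope L m.1 m.2, ∑ y ∈ pairEnvelope L m'.1 m'.2,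
        ∑ z ∈ pairEnvelope L m''.1 m''.2, (8 : ℝ) ^ #(chainFree L x y z) = 0 := by
      by_cases h1 : m.1 ≤ L ∧ m.2 ≤ L
      · by_cases h2 : m'.1 ≤ L ∧ m'.2 ≤ L
        · rw [empty m'' (by tauto)]; simp
        · rw [empty m' h2]; simp
      · rw [empty m h1]; simp
    rw [z]; positivity

theorem card_chainConfigs_le (L k : ℕ) :
    (#(chainConfigs L k) : ℝ) ≤ 2 ^ (2 * k * L + 14 * L + 26 * k) := by
  set R := range (L + 1) ×ˢ range (L + 1) with hR
  set S := subsetPairs L with hS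
  set N : Finset ℕ × Finset ℕ → Finset ℕ × Finset ℕ → Finset ℕ × Finset ℕ → ℝ :=
    fun x y z => (2 : ℝ) ^ #(chainFree L x y z) with hN
  have inner : ∀ m ∈ Fintype.piFinset (fun _ : Fin (k + 2) => R),
      ∑ Z ∈ Fintype.piFinset (fun _ : Fin (k + 2) => S) with (fun i => lowestPair L (Z i)) = m,
        chainProd (fun _ => N) Z ≤
      4 ^ (5 * L) * ((61 * 4 ^ L) ^ k *
        chainProd (fun _ x y z => (499 / 500 : ℝ) ^ deviation x y z) m) := by
    intro m _
    set F : Fin k → Finset ℕ × Finset ℕ → Finset ℕ × Finset ℕ → Finset ℕ × Finset ℕ → ℝ :=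
      fun e x y z => if lowestPair L x = m e.castSucc.castSucc ∧
        lowestPair L y = m e.succ.castSucc ∧ lowestPair L z = m e.succ.succ then
        (2 : ℝ) ^ #(chainFree L x y z) else 0 with hF
    have F0 : ∀ e x y z, 0 ≤ F e x y z := by
      intro e x y z
      simp only [hF]
      split_ifs <;> positivity
    -- The end terms of the chain occur in fewer than three factors; trivial weights `1` fill the
    -- gaps at one end, and all ends together cost `4 ^ (5 * L)`.
    have hh := sum_chainProd_le S k F (fun e => 61 * 4 ^ L * (499 / 500) ^
      deviation (m e.castSucc.castSucc) (m e.succ.castSucc) (m e.succ.succ)) (fun _ => 1)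
      (fun _ _ => 1) (4 ^ L) (16 ^ L) F0 (fun e => by positivity) (fun _ => zero_le_one)
      (fun _ _ => zero_le_one) (by positivity) (by positivity)
      (fun e => sum_chain_cube_le L _ _ _) ?_ ?_
    · calc _ = ∑ Z ∈ Fintype.piFinset (fun _ : Fin (k + 2) => S) with
            (fun i => lowestPair L (Z i)) = m, 1 * 1 * chainProd F Z := by
            refine sum_congr rfl fun Z hZ => ?_
            have hm := (mem_filter.1 hZ).2
            rw [one_mul, one_mul]
            refine prod_congr rfl fun e _ => ?_
            simp only [hF, hN]
            rw [if_pos ⟨congrFun hm _, congrFun hm _, congrFun hm _⟩]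
        _ ≤ _ := (sum_le_sum_of_subset_of_nonneg (filter_subset _ _) fun Z _ _ => by
            rw [one_mul, one_mul]; exact chainProd_nonneg F0 Z).trans hh
        _ = _ := by
            rw [prod_mul_distrib, prod_const, card_univ, Fintype.card_fin, hS, card_subsetPairs,
              show (16 : ℝ) = 4 * 4 by norm_num, mul_pow, pow_mul' 4 5 L]
            push_cast
            rw [chainProd]
            ring
    · simp only [one_pow, sum_const, nsmul_eq_mul, mul_one]
      rw [hS, card_subsetPairs]; push_cast
      exact le_self_pow₀ (one_le_pow₀ (by norm_num)) three_ne_zero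
    · simp only [one_pow, sum_const, nsmul_eq_mul, mul_one]
      rw [hS, card_subsetPairs]; push_cast
      rw [← mul_pow]; norm_num
      exact le_self_pow₀ (one_le_pow₀ (by norm_num)) three_ne_zero
  have maps : ∀ Z ∈ Fintype.piFinset (fun _ : Fin (k + 2) => S),
      (fun i => lowestPair L (Z i)) ∈ Fintype.piFinset (fun _ : Fin (k + 2) => R) := by
    intro Z _
    rw [Fintype.mem_piFinset]
    intro i
    simp only [hR, mem_product, mem_range, lowestPair]
    exact ⟨Nat.lt_succ_of_le (lowest_le _ _), Nat.lt_succ_of_le (lowest_le _ _)⟩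
  rw [card_chainConfigs, ← sum_fiberwise_of_maps_to maps]
  refine (sum_le_sum inner).trans ?_
  rw [← mul_sum, ← mul_sum]
  have last := sum_chainProd_le_of_sum_le R k
    (fun x y z => (499 / 500 : ℝ) ^ deviation x y z) 1000000 (fun _ _ _ => by positivity)
    (fun y z => sum_pow_deviation_le _ y z)
  have cardR : (#R : ℝ) ≤ 4 ^ L := by
    rw [hR, card_product, card_range]
    push_cast
    have : ((L : ℝ) + 1) ≤ 2 ^ L := by exact_mod_cast Nat.lt_two_pow_self (n := L)
    calc ((L : ℝ) + 1) * (L + 1) ≤ 2 ^ L * 2 ^ L := by gcongr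
      _ = 4 ^ L := by rw [← mul_pow]; norm_num
  calc _ ≤ (4 : ℝ) ^ (5 * L) * ((61 * 4 ^ L) ^ k * ((4 ^ L) ^ 2 * 1000000 ^ k)) := by
        gcongr
        exact last.trans (by gcongr)
    _ = 4 ^ (5 * L) * 4 ^ (2 * L) * 4 ^ (L * k) * 61000000 ^ k := by
        rw [mul_pow, show (61000000 : ℝ) = 61 * 1000000 by norm_num, mul_pow, ← pow_mul, ← pow_mul,
          mul_comm L 2]
        ring
    _ ≤ 4 ^ (5 * L) * 4 ^ (2 * L) * 4 ^ (L * k) * (2 ^ 26) ^ k := by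
        gcongr; norm_num
    _ = _ := by
        rw [show (4 : ℝ) = 2 ^ 2 by norm_num, ← pow_mul, ← pow_mul, ← pow_mul, ← pow_mul,
          ← pow_add, ← pow_add, ← pow_add]
        congr 1; ring

/-! ### Traces of a sum-free set on columns. -/

open Classical in
/-- The positions, in the part of the column `x` that starts on the line `x + y = t`, of the points
of `S`. -/
noncomputable def columnSlice (S : Set (ℤ × ℤ)) (L : ℕ) (x t : ℤ) : Finset ℕ :=
  (range L).filter fun i => (x, t + i - x) ∈ S

lemma mem_columnSlice {S : Set (ℤ × ℤ)} {L : ℕ} {x t : ℤ} {i : ℕ} :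
    i ∈ columnSlice S L x t ↔ i < L ∧ (x, t + i - x) ∈ S := by
  simp [columnSlice]

/-- The traces of `S` on the columns `x₀ + j` and `y₀ + j`, from the line `x + y = t` on, and on the
columns `x₀ + y₀ + 2 * j`, from the line `x + y = 2 * t` on. -/
noncomputable def columnConfig (S : Set (ℤ × ℤ)) (L k : ℕ) (x₀ y₀ t : ℤ) :
    Σ _ : Fin (k + 2) → Finset ℕ × Finset ℕ, Fin k → Finset ℕ :=
  ⟨fun j => (columnSlice S L (x₀ + (j : ℕ)) t, columnSlice S L (y₀ + (j : ℕ)) t),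
    fun e => columnSlice S L (x₀ + y₀ + 2 * ((e : ℕ) + 1)) (2 * t)⟩

lemma IsSumFreeSet.ne_of_mem_columnSlice {S : Set (ℤ × ℤ)} (hS : IsSumFreeSet S) {L : ℕ}
    {x y z t : ℤ} (h : x + y = z) {a b c : ℕ} (ha : a ∈ columnSlice S L x t)
    (hb : b ∈ columnSlice S L y t) (hc : c ∈ columnSlice S L z (2 * t)) : a + b ≠ c := by
  intro habc
  refine hS _ (mem_columnSlice.1 ha).2 _ (mem_columnSlice.1 hb).2 _ (mem_columnSlice.1 hc).2 ?_
  subst h habc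
  ext
  · rfl
  · simp only [Prod.snd_add]; push_cast; ring

lemma IsSumFreeSet.columnConfig_mem {S : Set (ℤ × ℤ)} (hS : IsSumFreeSet S) (L k : ℕ)
    (x₀ y₀ t : ℤ) : columnConfig S L k x₀ y₀ t ∈ chainConfigs L k := by
  have sub : ∀ x t, columnSlice S L x t ⊆ range L := fun x t i hi =>
    mem_range.2 (mem_columnSlice.1 hi).1
  simp only [chainConfigs, mem_sigma, Fintype.mem_piFinset, columnConfig, subsetPairs, mem_product,
    mem_powerset]
  refine ⟨fun j => ⟨sub _ _, sub _ _⟩, fun e c hc => ?_⟩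
  simp only [chainFree, unblocked, mem_filter, Fin.val_castSucc, Fin.val_succ]
  refine ⟨sub _ _ hc, ?_, ?_, ?_⟩ <;>
  · intro a ha b hb
    refine hS.ne_of_mem_columnSlice ?_ ha hb hc
    push_cast
    ring

/-- The points that `columnConfig` takes into account. -/
def columnCover (L k : ℕ) (x₀ y₀ t : ℤ) : Set (ℤ × ℤ) :=
  {p | ∃ i < L, (∃ j < k + 2, p = (x₀ + (j : ℕ), t + (i : ℕ) - (x₀ + (j : ℕ))) ∨
      p = (y₀ + (j : ℕ), t + (i : ℕ) - (y₀ + (j : ℕ)))) ∨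
    ∃ e < k, p = (x₀ + y₀ + 2 * ((e : ℕ) + 1), 2 * t + (i : ℕ) - (x₀ + y₀ + 2 * ((e : ℕ) + 1)))}

lemma columnSlice_eq_iff {S S' : Set (ℤ × ℤ)} {L : ℕ} {x t : ℤ}
    (h : columnSlice S L x t = columnSlice S' L x t) {i : ℕ} (hi : i < L) :
    (x, t + i - x) ∈ S ↔ (x, t + i - x) ∈ S' := by
  have := congrArg (i ∈ ·) h
  simpa [mem_columnSlice, hi] using this

lemma mem_iff_mem_of_columnConfig_eq {S S' : Set (ℤ × ℤ)} {L k : ℕ} {x₀ y₀ t : ℤ}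
    (h : columnConfig S L k x₀ y₀ t = columnConfig S' L k x₀ y₀ t) {p : ℤ × ℤ}
    (hp : p ∈ columnCover L k x₀ y₀ t) : p ∈ S ↔ p ∈ S' := by
  simp only [columnConfig, Sigma.mk.injEq, heq_eq_eq] at h
  obtain ⟨h1, h2⟩ := h
  obtain ⟨i, hi, ⟨j, hj, rfl | rfl⟩ | ⟨e, he, rfl⟩⟩ := hp
  · exact columnSlice_eq_iff (congrArg Prod.fst (congrFun h1 ⟨j, hj⟩)) hi
  · exact columnSlice_eq_iff (congrArg Prod.snd (congrFun h1 ⟨j, hj⟩)) hi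
  · exact columnSlice_eq_iff (congrFun h2 ⟨e, he⟩) hi

/-- A sum-free subset of `R` is determined by its two column configurations and its trace on `T`. -/
lemma sumFreeCount_le {R : Set (ℤ × ℤ)} {L k : ℕ} {x₀ y₀ x₁ y₁ t : ℤ} (T : Finset (ℤ × ℤ))
    (hT : ∀ p ∈ R, p ∉ columnCover L k x₀ y₀ t → p ∉ columnCover L k x₁ y₁ t → p ∈ T) :
    sumFreeCount R ≤ #(chainConfigs L k) * (#(chainConfigs L k) * 2 ^ #T) := by
  classical
  rw [← card_powerset, ← card_product, ← card_product, ← Set.ncard_coe_finset]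
  refine Set.ncard_le_ncard_of_injOn (fun S => (columnConfig S L k x₀ y₀ t,
    columnConfig S L k x₁ y₁ t, T.filter (· ∈ S))) ?_ ?_ (finite_toSet _)
  · rintro S ⟨-, hS⟩
    simp only [mem_coe, mem_product, mem_powerset]
    exact ⟨hS.columnConfig_mem _ _ _ _ _, hS.columnConfig_mem _ _ _ _ _, filter_subset _ _⟩
  · rintro S ⟨hS, -⟩ S' ⟨hS', -⟩ h
    simp only [Prod.mk.injEq] at h
    obtain ⟨h1, h2, h3⟩ := h
    have key : ∀ p ∈ R, p ∈ S ↔ p ∈ S' := by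
      intro p hp
      by_cases c1 : p ∈ columnCover L k x₀ y₀ t
      · exact mem_iff_mem_of_columnConfig_eq h1 c1
      by_cases c2 : p ∈ columnCover L k x₁ y₁ t
      · exact mem_iff_mem_of_columnConfig_eq h2 c2
      have := congrArg (p ∈ ·) h3
      simpa [hT p hp c1 c2] using this
    ext p
    exact ⟨fun hp => (key p (hS hp)).1 hp, fun hp => (key p (hS' hp)).2 hp⟩

/-! ### Geometry of the uncovered points and the final count. -/

/-- The triangle of pairs of natural numbers with sum less than `m`. -/
def triangle (m : ℕ) : Finset (ℕ × ℕ) := (range m ×ˢ range m).filter fun p => p.1 + p.2 < m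

lemma mem_triangle {m : ℕ} {p : ℕ × ℕ} : p ∈ triangle m ↔ p.1 + p.2 < m := by
  simp only [triangle, mem_filter, mem_product, mem_range]
  omega

lemma two_mul_card_triangle_le (m : ℕ) : 2 * #(triangle m) ≤ m ^ 2 + m := by
  induction m with
  | zero => simp [triangle]
  | succ m ih =>
    have h : triangle (m + 1) ⊆ triangle m ∪ antidiagonal m := by
      intro p hp
      rw [mem_triangle] at hp
      rw [mem_union, mem_triangle, HasAntidiagonal.mem_antidiagonal]
      omega
    have := (card_le_card h).trans (card_union_le _ _)
    rw [Nat.card_antidiagonal] at this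
    nlinarith

/-- A set containing the points of `latticePoints (regionR0 n)` outside the two column covers, where
`q = n / 10`. -/
def remainder (n q : ℕ) : Finset (ℤ × ℤ) :=
  (range (3 * q + 17)).image (fun i : ℕ => ((6 * q : ℤ), (q + i : ℤ))) ∪
  ((triangle (2 * q + 16)).image (fun p : ℕ × ℕ =>
    ((8 * q + 1 + p.1 : ℤ), (2 * q + 15 - p.1 - p.2 : ℤ))) ∪
  ((range (6 * q + 2) ×ˢ range (4 * q)).image (fun p : ℕ × ℕ =>
    ((n - p.1 : ℤ), (10 * q + 17 + p.2 - n + p.1 : ℤ))) ∪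
  ((triangle (4 * q)).image (fun p : ℕ × ℕ =>
    ((n - 6 * q - 2 - p.1 : ℤ), (16 * q + 19 + p.2 - n + p.1 : ℤ))) ∪
  ((triangle (2 * q + 11)).image (fun p : ℕ × ℕ =>
    ((6 * q + 1 - p.1 : ℤ), (8 * q - 1 + p.2 + p.1 : ℤ))) ∪
  (range 12 ×ˢ range (3 * q + 17)).image (fun p : ℕ × ℕ =>
    ((10 * q - 2 + p.1 : ℤ), (4 * q + 2 + p.2 - p.1 : ℤ)))))))

/-- The quadratic parts are `2q²` and `2q²` for the triangles in the low and high strips, and `24q²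
+ 8q²` for the middle strip; the other pieces are boundedly many columns. -/
lemma card_remainder_le (n : ℕ) {q : ℕ} (hq : 1 ≤ q) : #(remainder n q) ≤ 36 * q ^ 2 + 528 * q := by
  have h1 := two_mul_card_triangle_le (2 * q + 16)
  have h2 := two_mul_card_triangle_le (4 * q)
  have h3 := two_mul_card_triangle_le (2 * q + 11)
  have h : #(remainder n q) ≤ (3 * q + 17) + (#(triangle (2 * q + 16)) + ((6 * q + 2) * (4 * q) +
      (#(triangle (4 * q)) + (#(triangle (2 * q + 11)) + 12 * (3 * q + 17))))) := by
    unfold remainder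
    refine (card_union_le _ _).trans (add_le_add (card_image_le.trans (card_range _).le) ?_)
    refine (card_union_le _ _).trans (add_le_add card_image_le ?_)
    refine (card_union_le _ _).trans (add_le_add (card_image_le.trans (by simp)) ?_)
    refine (card_union_le _ _).trans (add_le_add card_image_le ?_)
    exact (card_union_le _ _).trans (add_le_add card_image_le (card_image_le.trans (by simp)))
  nlinarith

lemma mem_latticePoints_regionR0 {n : ℕ} {p : ℤ × ℤ} (hp : p ∈ latticePoints (regionR0 n)) :
    0 ≤ p.1 ∧ p.1 ≤ n ∧ 0 ≤ p.2 ∧ p.2 ≤ n ∧ 7 * n ≤ 10 * (p.1 + p.2) ∧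
      10 * (p.1 + p.2) ≤ 17 * n := by
  obtain ⟨⟨h1, h2⟩, ⟨h3, h4⟩, h5, h6⟩ := hp
  simp only at h1 h2 h3 h4 h5 h6
  refine ⟨by exact_mod_cast h1, by exact_mod_cast h2, by exact_mod_cast h3, by exact_mod_cast h4,
    ?_, ?_⟩
  · have : (7 : ℝ) * n ≤ 10 * (p.1 + p.2) := by linarith
    exact_mod_cast this
  · have : (10 : ℝ) * (p.1 + p.2) ≤ 17 * n := by linarith
    exact_mod_cast this

/-- The second chain starts at `6 * q + 1` rather than `6 * q`, so that the two chains reach the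
even and the odd high columns respectively; the skipped column `6 * q` goes into the remainder.
Length `3 * q + 17` absorbs the rounding `n ≤ 10 * q + 9`. -/
lemma mem_remainder {n k q : ℕ} (hq : q = n / 10) (hk : k + 2 = 2 * q) {p : ℤ × ℤ}
    (hp : p ∈ latticePoints (regionR0 n))
    (h1 : p ∉ columnCover (3 * q + 17) k (2 * q) (4 * q) (7 * q))
    (h2 : p ∉ columnCover (3 * q + 17) k 0 (6 * q + 1) (7 * q)) : p ∈ remainder n q := by
  obtain ⟨x0, xn, y0, yn, s7, s17⟩ := mem_latticePoints_regionR0 hp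
  obtain ⟨x, y⟩ := p
  simp only at x0 xn y0 yn s7 s17
  simp only [columnCover, Set.mem_ofPred_eq, not_exists, not_and, not_or, Prod.mk.injEq] at h1 h2
  simp only [remainder, mem_union, mem_image, mem_product, mem_range, Prod.exists, mem_triangle,
    Prod.mk.injEq]
  obtain ⟨x, rfl⟩ := Int.eq_ofNat_of_zero_le x0
  obtain ⟨y, rfl⟩ := Int.eq_ofNat_of_zero_le y0
  rcases lt_or_ge (x + y) (10 * q + 17) with hA | hA
  · obtain ⟨i, hi⟩ := Nat.exists_eq_add_of_le (show 7 * q ≤ x + y by omega)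
    have a1 := (h1 i (by omega)).1
    have a2 := (h2 i (by omega)).1
    by_cases e : x = 6 * q
    · exact Or.inl ⟨i, by omega, by omega, by omega⟩
    have hx : 8 * q + 1 ≤ x := by
      by_contra hx
      rcases lt_or_ge x (2 * q) with c | c
      · exact (a2 x (by omega)).1 (by omega) (by omega)
      rcases lt_or_ge x (4 * q) with c' | c'
      · exact (a1 (x - 2 * q) (by omega)).1 (by omega) (by omega)
      rcases lt_or_ge x (6 * q) with c'' | c''
      · exact (a1 (x - 4 * q) (by omega)).2 (by omega) (by omega)
      · exact (a2 (x - (6 * q + 1)) (by omega)).2 (by omega) (by omega)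
    exact Or.inr (Or.inl ⟨x - (8 * q + 1), 10 * q + 16 - (x + y), by omega, by omega, by omega⟩)
  rcases lt_or_ge (x + y) (14 * q) with hB | hB
  · rcases lt_or_ge (n - x) (6 * q + 2) with c | c
    · exact Or.inr (Or.inr (Or.inl ⟨n - x, x + y - (10 * q + 17), by omega, by omega, by omega⟩))
    · exact Or.inr (Or.inr (Or.inr (Or.inl ⟨n - x - (6 * q + 2), x + y - (10 * q + 17),
        by omega, by omega, by omega⟩)))
  rcases lt_or_ge x (6 * q + 2) with c | c
  · exact Or.inr (Or.inr (Or.inr (Or.inr (Or.inl ⟨6 * q + 1 - x, x + y - 14 * q,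
      by omega, by omega, by omega⟩))))
  rcases lt_or_ge x (10 * q - 2) with c' | c'
  · exfalso
    have a1 := (h1 (x + y - 14 * q) (by omega)).2
    have a2 := (h2 (x + y - 14 * q) (by omega)).2
    rcases Nat.even_or_odd' x with ⟨j, rfl | rfl⟩
    · exact a1 (j - 3 * q - 1) (by omega) (by omega) (by omega)
    · exact a2 (j - 3 * q - 1) (by omega) (by omega) (by omega)
  · exact Or.inr (Or.inr (Or.inr (Or.inr (Or.inr ⟨x - (10 * q - 2), x + y - 14 * q,
      by omega, by omega, by omega⟩))))

lemma sumFreeCount_le_two_pow_ncard {G : Type*} [AddCommGroup G] {R : Set G} (hR : R.Finite) :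
    sumFreeCount R ≤ 2 ^ R.ncard := by
  rw [← Set.ncard_powerset R hR]
  exact Set.ncard_le_ncard (fun S hS => hS.1) hR.finite_subsets

lemma ncard_latticePoints_regionR0_le (n : ℕ) :
    (latticePoints (regionR0 n)).ncard ≤ (n + 1) ^ 2 := by
  have h : latticePoints (regionR0 n) ⊆ ↑(Icc (0 : ℤ) n ×ˢ Icc (0 : ℤ) n) := by
    intro p hp
    obtain ⟨h1, h2, h3, h4, -⟩ := mem_latticePoints_regionR0 hp
    exact mem_coe.2 (mem_product.2 ⟨mem_Icc.2 ⟨h1, h2⟩, mem_Icc.2 ⟨h3, h4⟩⟩)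
  refine (Set.ncard_le_ncard h (finite_toSet _)).trans ?_
  rw [Set.ncard_coe_finset, card_product, Int.card_Icc]
  simp [sq]

lemma sumFreeCount_regionR0_le {n k q : ℕ} (hq : q = n / 10) (hk : k + 2 = 2 * q) :
    (sumFreeCount (latticePoints (regionR0 n)) : ℝ) ≤ 2 ^ (60 * q ^ 2 + 1328 * q) := by
  have h := sumFreeCount_le (remainder n q) fun p hp h1 h2 => mem_remainder hq hk hp h1 h2
  have hc := card_chainConfigs_le (3 * q + 17) k
  have hr := card_remainder_le n (show 1 ≤ q by omega)
  obtain ⟨m, rfl⟩ : ∃ m, q = m + 1 := ⟨q - 1, by omega⟩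
  obtain rfl : k = 2 * m := by omega
  set E := 2 * (2 * m) * (3 * (m + 1) + 17) + 14 * (3 * (m + 1) + 17) + 26 * (2 * m) with hE
  -- Each chain contributes `12q² + O(q)`, so the quadratic terms are `12 + 12 + 36 = 60`.
  have hE' : E + (E + (36 * (m + 1) ^ 2 + 528 * (m + 1))) ≤ 60 * (m + 1) ^ 2 + 1328 * (m + 1) := by
    clear_value E
    linarith
  clear_value E
  calc (sumFreeCount (latticePoints (regionR0 n)) : ℝ)
      ≤ #(chainConfigs (3 * (m + 1) + 17) (2 * m)) *
        (#(chainConfigs (3 * (m + 1) + 17) (2 * m)) * 2 ^ #(remainder n (m + 1))) := by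
        exact_mod_cast h
    _ ≤ 2 ^ E * (2 ^ E * 2 ^ (36 * (m + 1) ^ 2 + 528 * (m + 1))) := by
        gcongr
        norm_num
    _ = 2 ^ (E + (E + (36 * (m + 1) ^ 2 + 528 * (m + 1)))) := by rw [← pow_add, ← pow_add]
    _ ≤ _ := pow_le_pow_right₀ one_le_two hE'

end

theorem mainTheorem4 :
    ∃ C : ℝ, ∀ n : ℕ, 1 ≤ n →
      (sumFreeCount (latticePoints (regionR0 n)) : ℝ) ≤
        (2 : ℝ) ^ (0.6 * (n : ℝ) ^ 2 + C * (n : ℝ)) := by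
  refine ⟨200, fun n hn => ?_⟩
  have hn' : (1 : ℝ) ≤ n := by exact_mod_cast hn
  rcases lt_or_ge n 10 with h | h
  · have hb : (sumFreeCount (latticePoints (regionR0 n)) : ℝ) ≤ 2 ^ ((n + 1) ^ 2) := by
      exact_mod_cast (sumFreeCount_le_two_pow_ncard (latticePoints_regionR0_finite n)).trans
        (Nat.pow_le_pow_right two_pos (ncard_latticePoints_regionR0_le n))
    refine hb.trans ?_
    rw [← Real.rpow_natCast]
    refine Real.rpow_le_rpow_of_exponent_le one_le_two ?_
    have : (n : ℝ) ≤ 9 := by exact_mod_cast Nat.lt_succ_iff.1 h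
    push_cast
    nlinarith
  · obtain ⟨q, hq⟩ : ∃ q, q = n / 10 := ⟨_, rfl⟩
    refine (sumFreeCount_regionR0_le (k := 2 * q - 2) hq (by omega)).trans ?_
    rw [← Real.rpow_natCast]
    refine Real.rpow_le_rpow_of_exponent_le one_le_two ?_
    have : (10 : ℝ) * q ≤ n := by exact_mod_cast (show 10 * q ≤ n by omega)
    have : (0 : ℝ) ≤ q := q.cast_nonneg
    push_cast
    nlinarith
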